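/- Let $n\ge 1$, $\nu\ge 0$, $\beta>0$, $L>0$ and $\ell\ge 0$. There is a constant $C$, depending only on $(n,\nu,\beta,L,\ell)$, such that the following holds. Let $\mathcal X\subseteq\mathbb R^n$ be a closed convex set with non-empty interior, and let $R:\operatorname{int}(\mathcal X)\to\mathbb R$ be a $\nu$-self-concordant barrier for $\mathcal X$: $R$ is convex and $C^3$, $R(x)\to\infty$ as $x\to\partial\mathcal X$, and for all $x\in\operatorname{int}(\mathcal X)$, $h\in\mathbb R^n$, $$|\nabla^3R(x)[h,h,h]|\le 2\,(h^\top\nabla^2R(x)h)^{3/2},\qquad |\nabla R(x)^\top h|\le\sqrt{\nu}\,(h^\top\nabla^2R(x)h)^{1/2}.$$ Let $T\ge1$ and let $f_1,\dots,f_T:\mathcal X\to\mathbb R$ be fixed in advance, each being $\beta$-strongly concave and Lipschitz continuous on $\mathcal X$, with $|f_t|\le L$ on $\mathcal X$, and differentiable in $\operatorname{int}(\mathcal X)$ with $\ell$-Lipschitz gradient. Put $\eta_t=\frac{1}{2nL\sqrt T}$ and let $z^1,z^2,\dots$ be independent and uniformly distributed on the unit sphere of $\mathbb R^n$. Run the following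 algorithm (eager self-concordant barrier bandit learning): $x^1=\operatorname{argmin}_{\operatorname{int}(\mathcal X)}R$ and, for $t=1,2,\dots$, $$A^t=(\nabla^2R(x^t)+\eta_t\beta(t+1)I_n)^{-1/2},\qquad \hat x^t=x^t+A^tz^t,\qquad \hat v^t=n f_t(\hat x^t)(A^t)^{-1}z^t,$$ $$x^{t+1}=\operatorname*{argmin}_{x'\in\operatorname{int}(\mathcal X)}\Big\{\eta_t\langle\hat v^t,x^t-x'\rangle+\tfrac{\eta_t\beta(t+1)}2\|x^t-x'\|^2+D_R(x',x^t)\Big\},$$ where $D_R(x',x)=R(x')-R(x)-\langle\nabla R(x),x'-x\rangle$ and $\hat x^t$ is the point played in round $t$. Then, for $t=1,\dots,T$, $x^t\in\operatorname{int}(\mathcal X)$, $\hat x^t\in\mathcal X$, and $f_t(x^t)$ and $f_t(\hat x^t)$ are integrable. Moreover the expected regret is $\tilde O(\sqrt T)$, both for the played points and for the pivots: for $y^t=\hat x^t$ as well as for $y^t=x^t$ the maximum below is attained and $$\max_{p\in\mathcal X}\Big\{\sum_{t=1}^Tf_t(p)-\mathbb E\Big[\sum_{t=1}^Tf_t(y^t)\Big]\Big\}\le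 C\sqrt T\,(1+\log T).$$ -/

import Mathlib

open MeasureTheory ProbabilityTheory Filter Topology Set
open scoped NNReal Gradient

noncomputable section

namespace EagerBandit

/-- The Euclidean space `ℝⁿ`. -/
abbrev Eucl (n : ℕ) : Type := EuclideanSpace ℝ (Fin n)

/-- The Hessian `∇²R(x)`, as a linear operator: the derivative of the gradient field. -/
def hess {n : ℕ} (R : Eucl n → ℝ) (x : Eucl n) : Eucl n →L[ℝ] Eucl n :=
  fderiv ℝ (∇ R) x

/-- The Hessian `∇²R(x)` as a matrix in the standard basis. -/
def hessMatrix {n : ℕ} (R : Eucl n → ℝ) (x : Eucl n) : Matrix (Fin n) (Fin n) ℝ :=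
  (Matrix.toEuclideanCLM (n := Fin n) (𝕜 := ℝ)).symm (hess R x)

/-- `R` is a `ν`-self-concordant barrier for `X`. Only the values of `R` on the interior of `X`
matter. Convexity is part of the notion: it makes the powers of `hᵀ ∇²R(x) h` meaningful. -/
structure IsSelfConcordantBarrier {n : ℕ} (ν : ℝ) (X : Set (Eucl n)) (R : Eucl n → ℝ) : Prop where
  convexOn : ConvexOn ℝ (interior X) R
  contDiffOn : ContDiffOn ℝ 3 R (interior X)
  tendsto_boundary : ∀ y ∈ frontier X, Tendsto R (𝓝[interior X] y) atTop
  third_le : ∀ x ∈ interior X, ∀ h : Eucl n,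
    |iteratedFDeriv ℝ 3 R x (fun _ => h)| ≤ 2 * (inner ℝ h (hess R x h)) ^ (3 / 2 : ℝ)
  first_le : ∀ x ∈ interior X, ∀ h : Eucl n,
    |inner ℝ (∇ R x) h| ≤ √ν * √(inner ℝ h (hess R x h))

/-- A minimizer of `g` over `S` (if there is one). -/
def argmin {n : ℕ} (S : Set (Eucl n)) (g : Eucl n → ℝ) : Eucl n :=
  Classical.epsilon fun y => y ∈ S ∧ IsMinOn g S y

/-- The Bregman divergence `D_R(x', x) = R(x') - R(x) - ⟨∇R(x), x' - x⟩`. -/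
def bregman {n : ℕ} (R : Eucl n → ℝ) (x' x : Eucl n) : ℝ :=
  R x' - R x - inner ℝ (∇ R x) (x' - x)

/-- The prox-mapping of round `t` for the mixed Bregman divergence. The barrier is `+∞` on the
boundary of `X`, so the minimum over `X` is the one over the interior. -/
def prox {n : ℕ} (X : Set (Eucl n)) (R : Eucl n → ℝ) (β : ℝ) (t : ℕ)
    (x v : Eucl n) (η : ℝ) : Eucl n :=
  argmin (interior X) fun x' =>
    η * inner ℝ v (x - x') + η * β * ((t : ℝ) + 1) / 2 * ‖x - x'‖ ^ 2 + bregman R x' x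

/-- The scaling matrix `(∇²R(x) + η β (t + 1) I)^{-1/2}` of round `t` at the pivot `x`; the power
is taken by the functional calculus of symmetric matrices. -/
def scaling {n : ℕ} (R : Eucl n → ℝ) (β : ℝ) (t : ℕ) (x : Eucl n) (η : ℝ) :
    Matrix (Fin n) (Fin n) ℝ :=
  cfc (fun r : ℝ => (√r)⁻¹) (hessMatrix R x + (η * β * ((t : ℝ) + 1)) • 1)

/-- The point `x + A z` that is played from the pivot `x` in round `t` with direction `z`. -/
def play {n : ℕ} (R : Eucl n → ℝ) (β : ℝ) (t : ℕ) (x z : Eucl n) (η : ℝ) : Eucl n :=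
  x + Matrix.toEuclideanCLM (𝕜 := ℝ) (scaling R β t x η) z

/-- The single-shot ellipsoidal estimator `n f(x + A z) A⁻¹ z`. -/
def gradEst {n : ℕ} (R : Eucl n → ℝ) (β : ℝ) (t : ℕ) (f : Eucl n → ℝ) (x z : Eucl n) (η : ℝ) :
    Eucl n :=
  ((n : ℝ) * f (play R β t x z η)) • Matrix.toEuclideanCLM (𝕜 := ℝ) (scaling R β t x η)⁻¹ z

/-- The pivots `x¹, x², …` of the algorithm along a sequence `z¹, z², …` of directions.
Rounds are numbered from `1`; the value at `0` is a dummy. -/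
def pivot {n : ℕ} (X : Set (Eucl n)) (R : Eucl n → ℝ) (β : ℝ) (η : ℕ → ℝ)
    (f : ℕ → Eucl n → ℝ) (z : ℕ → Eucl n) : ℕ → Eucl n
  | 0 => argmin (interior X) R
  | 1 => argmin (interior X) R
  | t + 2 =>
    prox X R β (t + 1) (pivot X R β η f z (t + 1))
      (gradEst R β (t + 1) (f (t + 1)) (pivot X R β η f z (t + 1)) (z (t + 1)) (η (t + 1)))
      (η (t + 1))

/-- The actions `x̂¹, x̂², …` that the algorithm plays. -/
def action {n : ℕ} (X : Set (Eucl n)) (R : Eucl n → ℝ) (β : ℝ) (η : ℕ → ℝ)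
    (f : ℕ → Eucl n → ℝ) (z : ℕ → Eucl n) (t : ℕ) : Eucl n :=
  play R β t (pivot X R β η f z t) (z t) (η t)

/-- The uniform probability measure on the unit sphere of `ℝⁿ` (for `n ≥ 1`). -/
def sphereUniform (n : ℕ) : Measure (Metric.sphere (0 : Eucl n) 1) :=
  ((volume : Measure (Eucl n)).toSphere univ)⁻¹ • (volume : Measure (Eucl n)).toSphere

/-- `r = max_{p ∈ X} {∑_{t=1}^T f_t(p) - E[∑_{t=1}^T f_t(y^t)]}`: the maximum is attained and
equals `r`. -/
def IsRegret {n : ℕ} {Ω : Type*} [MeasurableSpace Ω] (P : Measure Ω) (X : Set (Eucl n))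
    (T : ℕ) (f : ℕ → Eucl n → ℝ) (y : ℕ → Ω → Eucl n) (r : ℝ) : Prop :=
  IsGreatest ((fun p => ∑ t ∈ Finset.Icc 1 T, f t p
    - ∫ ω, ∑ t ∈ Finset.Icc 1 T, f t (y t ω) ∂P) '' X) r

/-- The rewards that the adversary may choose: on `X`, `f` is `β`-strongly concave, Lipschitz and
bounded by `L`, and it is differentiable with `ℓ`-Lipschitz gradient in the interior. -/
structure IsReward {n : ℕ} (X : Set (Eucl n)) (β L : ℝ) (ℓ : ℝ≥0) (f : Eucl n → ℝ) : Prop where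
  strongConcaveOn : StrongConcaveOn X β f
  differentiableOn : DifferentiableOn ℝ f (interior X)
  smooth : LipschitzOnWith ℓ (∇ f) (interior X)
  lipschitz : ∃ G : ℝ≥0, LipschitzOnWith G f X
  bounded : ∀ x ∈ X, |f x| ≤ L

end EagerBandit

end

/-!
For concave rewards, the quadratic model `⟨∇f(x), p - x⟩ - β / 2 ‖p - x‖²` dominates `f p - f x`,
and by the divergence theorem the single-shot estimator is unbiased for the mean of `∇f` over the
ellipsoid `x + A 𝔹`. Averages of `f` and of its tangents over this ellipsoid or its boundary differ
from the values at the pivot by `O(ℓ ‖A‖²)`, that is, by `O(ℓ / (η β t))`, which sums to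
`O(log T / η)`.

Along every sequence of directions the sum of the quadratic models is bounded by mirror descent with
the mixed Bregman divergence: the strong concavity terms raise its curvature parameter from `η β t`
to `η β (t + 1)`, so that the potentials telescope, and self-concordance makes each step stable in
the local norm, in which the estimator has dual norm at most `n L`. Comparison with a point of `X`
shrunk by `1 / T` towards the minimizer of the barrier costs `ν log T / η`; with `η ~ 1 / √T`
everything is `O(√T log T)`.
-/

namespace EagerBandit

/-! ### Differential inequalities on an interval -/

lemma sub_le_sub_of_hasDerivAt_le {f f' g g' : ℝ → ℝ} {a b : ℝ} (hab : a ≤ b)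
    (hf : ∀ s ∈ Icc a b, HasDerivAt f (f' s) s) (hg : ∀ s ∈ Icc a b, HasDerivAt g (g' s) s)
    (hfg : ∀ s ∈ Icc a b, f' s ≤ g' s) : f b - f a ≤ g b - g a := by
  have hd : ∀ s ∈ Icc a b, HasDerivAt (g - f) (g' s - f' s) s := fun s hs =>
    (hg s hs).sub (hf s hs)
  have hmono : MonotoneOn (g - f) (Icc a b) :=
    monotoneOn_of_hasDerivWithinAt_nonneg (convex_Icc a b)
      (fun s hs => (hd s hs).continuousAt.continuousWithinAt)
      (fun s hs => (hd s (interior_subset hs)).hasDerivWithinAt)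
      fun s hs => sub_nonneg.2 (hfg s (interior_subset hs))
  have hle := hmono (left_mem_Icc.2 hab) (right_mem_Icc.2 hab) hab
  simp only [Pi.sub_apply] at hle
  linarith

lemma le_quadratic_of_second_deriv_le {φ φ' q : ℝ → ℝ} {b M : ℝ} (hb : 0 ≤ b)
    (hφ : ∀ s ∈ Icc 0 b, HasDerivAt φ (φ' s) s) (hφ' : ∀ s ∈ Icc 0 b, HasDerivAt φ' (q s) s)
    (hq : ∀ s ∈ Icc 0 b, q s ≤ M) : φ b ≤ φ 0 + φ' 0 * b + M / 2 * b ^ 2 := by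
  have hslope : ∀ s ∈ Icc 0 b, φ' s ≤ φ' 0 + M * s := fun s hs => by
    have hsub : ∀ r ∈ Icc 0 s, r ∈ Icc 0 b := fun r hr => ⟨hr.1, hr.2.trans hs.2⟩
    have h := sub_le_sub_of_hasDerivAt_le hs.1 (fun r hr => hφ' r (hsub r hr))
      (fun r _ => (hasDerivAt_id r).const_mul M) fun r hr => by simpa using hq r (hsub r hr)
    simp only [id_eq, mul_zero, sub_zero] at h
    linarith
  have h := sub_le_sub_of_hasDerivAt_le (g := fun s => φ' 0 * s + M / 2 * s ^ 2) hb hφ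
    (fun s _ => ((hasDerivAt_id s).const_mul _).add ((hasDerivAt_pow 2 s).const_mul _))
    fun s hs => (hslope s hs).trans_eq (by simp; ring)
  simp only [mul_zero, ne_eq, OfNat.ofNat_ne_zero, not_false_eq_true, zero_pow, add_zero,
    sub_zero] at h
  linarith

section SelfConcordant

variable {q q' : ℝ → ℝ} {b : ℝ}

-- The derivative of `1 / √q` is `-q' / (2 q ^ (3 / 2))`, so self-concordance makes it 1-Lipschitz.
lemma abs_inv_sqrt_sub_inv_sqrt_le (hb : 0 ≤ b)
    (hq : ∀ s ∈ Icc 0 b, HasDerivAt q (q' s) s) (hpos : ∀ s ∈ Icc 0 b, 0 < q s)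
    (hq' : ∀ s ∈ Icc 0 b, |q' s| ≤ 2 * q s ^ (3 / 2 : ℝ)) :
    |(√(q b))⁻¹ - (√(q 0))⁻¹| ≤ b := by
  have hderiv : ∀ s ∈ Icc 0 b, HasDerivWithinAt (fun s => (√(q s))⁻¹)
      (-(q' s / (2 * √(q s))) / √(q s) ^ 2) (Icc 0 b) s := fun s hs =>
    (((hq s hs).sqrt (hpos s hs).ne').inv (Real.sqrt_pos.2 (hpos s hs)).ne').hasDerivWithinAt
  have hbound : ∀ s ∈ Icc 0 b, ‖-(q' s / (2 * √(q s))) / √(q s) ^ 2‖ ≤ 1 := fun s hs => by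
    have hqs := hpos s hs
    have := Real.sqrt_pos.2 hqs
    have hpow : q s ^ (3 / 2 : ℝ) = q s * √(q s) := by
      rw [show (3 / 2 : ℝ) = 1 + 1 / 2 by norm_num, Real.rpow_add hqs, Real.rpow_one,
        Real.sqrt_eq_rpow]
    rw [Real.norm_eq_abs, abs_div, abs_neg, abs_div, abs_of_pos (by positivity : 0 < 2 * √(q s)),
      Real.sq_sqrt hqs.le, abs_of_pos hqs, div_div, div_le_one (by positivity)]
    linarith [hq' s hs]
  simpa [abs_of_nonneg hb] using (convex_Icc 0 b).norm_image_sub_le_of_norm_hasDerivWithin_le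
    hderiv hbound (left_mem_Icc.2 hb) (right_mem_Icc.2 hb)

lemma div_one_add_le_sqrt_of_selfConcordant (hb : 0 ≤ b)
    (hq : ∀ s ∈ Icc 0 b, HasDerivAt q (q' s) s) (hpos : ∀ s ∈ Icc 0 b, 0 < q s)
    (hq' : ∀ s ∈ Icc 0 b, |q' s| ≤ 2 * q s ^ (3 / 2 : ℝ)) :
    √(q 0) / (1 + b * √(q 0)) ≤ √(q b) := by
  have hinv := (abs_le.1 (abs_inv_sqrt_sub_inv_sqrt_le hb hq hpos hq')).2
  have h0 := Real.sqrt_pos.2 (hpos 0 (left_mem_Icc.2 hb))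
  rw [← inv_div]
  refine inv_le_of_inv_le₀ (Real.sqrt_pos.2 (hpos b (right_mem_Icc.2 hb))) ?_
  rw [add_div, mul_div_cancel_right₀ _ h0.ne', one_div]
  linarith

lemma sqrt_le_div_one_sub_of_selfConcordant (hb : 0 ≤ b)
    (hq : ∀ s ∈ Icc 0 b, HasDerivAt q (q' s) s) (hpos : ∀ s ∈ Icc 0 b, 0 < q s)
    (hq' : ∀ s ∈ Icc 0 b, |q' s| ≤ 2 * q s ^ (3 / 2 : ℝ)) (hlt : b * √(q 0) < 1) :
    √(q b) ≤ √(q 0) / (1 - b * √(q 0)) := by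
  have hinv := (abs_le.1 (abs_inv_sqrt_sub_inv_sqrt_le hb hq hpos hq')).1
  have h0 := Real.sqrt_pos.2 (hpos 0 (left_mem_Icc.2 hb))
  rw [← inv_div]
  refine le_inv_of_le_inv₀ (div_pos (sub_pos.2 hlt) h0) ?_
  rw [sub_div, mul_div_cancel_right₀ _ h0.ne', one_div]
  linarith

end SelfConcordant

lemma sub_log_one_add_le {φ φ' q : ℝ → ℝ} {a : ℝ} (ha : 0 ≤ a)
    (hφ : ∀ s ∈ Icc (0 : ℝ) 1, HasDerivAt φ (φ' s) s)
    (hφ' : ∀ s ∈ Icc (0 : ℝ) 1, HasDerivAt φ' (q s) s)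
    (hq : ∀ s ∈ Icc (0 : ℝ) 1, (a / (1 + s * a)) ^ 2 ≤ q s) :
    a - Real.log (1 + a) ≤ φ 1 - φ 0 - φ' 0 := by
  have hden : ∀ s : ℝ, 0 ≤ s → 0 < 1 + s * a := fun s hs => by positivity
  have hlin : ∀ s : ℝ, HasDerivAt (fun s => 1 + s * a) a s := fun s => by
    simpa using ((hasDerivAt_id s).mul_const a).const_add 1
  have hslope : ∀ s ∈ Icc (0 : ℝ) 1, a - a / (1 + s * a) ≤ φ' s - φ' 0 := fun s hs => by
    have hsub : ∀ r ∈ Icc 0 s, r ∈ Icc (0 : ℝ) 1 := fun r hr => ⟨hr.1, hr.2.trans hs.2⟩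
    have h := sub_le_sub_of_hasDerivAt_le hs.1
      (fun r hr => (hasDerivAt_const r (-a)).div (hlin r) (hden r hr.1).ne')
      (fun r hr => hφ' r (hsub r hr)) fun r hr => by
        simpa [div_pow, ← pow_two] using hq r (hsub r hr)
    simp only [Pi.div_apply, zero_mul, add_zero, div_one, neg_div] at h
    linarith
  have h := sub_le_sub_of_hasDerivAt_le zero_le_one
    (fun s hs => ((hasDerivAt_id s).mul_const a).sub ((hlin s).log (hden s hs.1).ne'))
    (fun s hs => (hφ s hs).sub ((hasDerivAt_id s).mul_const (φ' 0)))
    fun s hs => by simpa using hslope s hs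
  simp only [Pi.sub_apply, id_eq, one_mul, zero_mul, add_zero, Real.log_one, sub_zero] at h
  linarith

section Barrier

variable {φ φ' q : ℝ → ℝ} {ν : ℝ}

-- While `φ'` is positive, `-1 / φ'` grows at rate at least `1 / ν`.
lemma mul_sub_le_of_sq_le (hφ' : ∀ s ∈ Ico (0 : ℝ) 1, HasDerivAt φ' (q s) s)
    (hq : ∀ s ∈ Ico (0 : ℝ) 1, φ' s ^ 2 ≤ ν * q s) {s r : ℝ} (hs : 0 ≤ s) (hsr : s ≤ r)
    (hr : r < 1) (hν : 0 < ν) (hpos : 0 < φ' s) : φ' s * (r - s) ≤ ν := by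
  have hsub : ∀ y ∈ Icc s r, y ∈ Ico (0 : ℝ) 1 := fun y hy => ⟨hs.trans hy.1, hy.2.trans_lt hr⟩
  have hpos' : ∀ y ∈ Icc s r, 0 < φ' y := fun y hy => by
    have hsy : ∀ w ∈ Icc s y, w ∈ Ico (0 : ℝ) 1 := fun w hw => hsub w ⟨hw.1, hw.2.trans hy.2⟩
    have h := sub_le_sub_of_hasDerivAt_le hy.1 (fun w _ => hasDerivAt_const w 0)
      (fun w hw => hφ' w (hsy w hw)) fun w hw =>
        nonneg_of_mul_nonneg_right ((sq_nonneg _).trans (hq w (hsy w hw))) hν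
    linarith
  have hgrowth := sub_le_sub_of_hasDerivAt_le hsr (fun y _ => (hasDerivAt_id y).div_const ν)
    (fun y hy => ((hφ' y (hsub y hy)).inv (hpos' y hy).ne').neg) fun y hy => by
      have := hpos' y hy
      rw [neg_div, neg_neg, div_le_div_iff₀ hν (by positivity)]
      linarith [hq y (hsub y hy)]
  have hinv : (r - s) / ν ≤ (φ' s)⁻¹ := by
    have := inv_pos.2 (hpos' r (right_mem_Icc.2 hsr))
    simp only [id_eq, Pi.neg_apply, Pi.inv_apply, ← sub_div] at hgrowth
    linarith
  rw [div_le_iff₀ hν, inv_mul_eq_div, le_div_iff₀ hpos] at hinv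
  linarith

lemma deriv_mul_one_sub_le_of_sq_le (hν : 0 ≤ ν)
    (hφ' : ∀ s ∈ Ico (0 : ℝ) 1, HasDerivAt φ' (q s) s)
    (hq : ∀ s ∈ Ico (0 : ℝ) 1, φ' s ^ 2 ≤ ν * q s) {s : ℝ} (hs : s ∈ Ico (0 : ℝ) 1) :
    φ' s * (1 - s) ≤ ν := by
  rcases le_or_gt (φ' s) 0 with hneg | hpos
  · exact (mul_nonpos_of_nonpos_of_nonneg hneg (sub_nonneg.2 hs.2.le)).trans hν
  have hν' : 0 < ν := hν.lt_of_ne fun h => by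
    have := hq s hs
    rw [← h, zero_mul] at this
    exact this.not_gt (by positivity)
  have hlim : Tendsto (fun r => φ' s * (r - s)) (𝓝[<] 1) (𝓝 (φ' s * (1 - s))) :=
    (Continuous.tendsto (by fun_prop) 1).mono_left nhdsWithin_le_nhds
  refine le_of_tendsto hlim ?_
  filter_upwards [Ico_mem_nhdsLT hs.2] with r hr
  exact mul_sub_le_of_sq_le hφ' hq hs.1 hr.1 hr.2 hν' hpos

lemma sub_le_mul_log_of_sq_le (hν : 0 ≤ ν) (hφ : ∀ s ∈ Ico (0 : ℝ) 1, HasDerivAt φ (φ' s) s)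
    (hφ' : ∀ s ∈ Ico (0 : ℝ) 1, HasDerivAt φ' (q s) s)
    (hq : ∀ s ∈ Ico (0 : ℝ) 1, φ' s ^ 2 ≤ ν * q s) {b : ℝ} (hb : b ∈ Ico (0 : ℝ) 1) :
    φ b - φ 0 ≤ ν * Real.log (1 / (1 - b)) := by
  have hsub : ∀ y ∈ Icc 0 b, y ∈ Ico (0 : ℝ) 1 := fun y hy => ⟨hy.1, hy.2.trans_lt hb.2⟩
  have h := sub_le_sub_of_hasDerivAt_le hb.1 (fun y hy => hφ y (hsub y hy))
    (fun y hy => (((hasDerivAt_id y).const_sub 1).log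
      (sub_pos.2 (hsub y hy).2).ne').const_mul (-ν)) fun y hy => by
      have hy1 : 0 < 1 - y := sub_pos.2 (hsub y hy).2
      have hkey := deriv_mul_one_sub_le_of_sq_le hν hφ' hq (hsub y hy)
      rw [← le_div_iff₀ hy1] at hkey
      exact hkey.trans_eq (by simp [div_eq_mul_inv])
  rw [one_div, Real.log_inv]
  simpa using h

end Barrier

/-! ### Gradients, Hessians and convexity -/

lemma add_fderiv_le_of_convexOn {E : Type*} [NormedAddCommGroup E] [NormedSpace ℝ E] {S : Set E}
    {f : E → ℝ} {f' : E →L[ℝ] ℝ} {x y : E} (hf : ConvexOn ℝ S f) (hx : x ∈ S) (hy : y ∈ S)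
    (hf' : HasFDerivAt f f' x) : f x + f' (y - x) ≤ f y := by
  have hline : HasDerivAt (f ∘ AffineMap.lineMap (k := ℝ) x y) (f' (y - x)) 0 := by
    refine HasFDerivAt.comp_hasDerivAt (0 : ℝ) ?_ AffineMap.hasDerivAt_lineMap
    rwa [AffineMap.lineMap_apply_zero]
  have h := (hf.comp_affineMap (AffineMap.lineMap x y)).le_slope_of_hasDerivAt
    (x := 0) (y := 1) (by simpa using hx) (by simpa using hy) zero_lt_one hline
  simp only [slope_def_field, Function.comp_apply, AffineMap.lineMap_apply_zero,
    AffineMap.lineMap_apply_one, sub_zero, div_one] at h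
  linarith

lemma contDiffAt_gradient {E : Type*} [NormedAddCommGroup E] [InnerProductSpace ℝ E]
    [CompleteSpace E] {f : E → ℝ} {x : E} {k m : WithTop ℕ∞} (hf : ContDiffAt ℝ m f x)
    (hkm : k + 1 ≤ m) : ContDiffAt ℝ k (∇ f) x :=
  (InnerProductSpace.toDual ℝ E).symm.toContinuousLinearEquiv.contDiff.contDiffAt.comp x
    (hf.fderiv_right hkm)

section Hessian

variable {n : ℕ} {R : Eucl n → ℝ} {x y d : Eucl n} {S : Set (Eucl n)}

lemma contDiffAt_hess {k m : WithTop ℕ∞} (hR : ContDiffAt ℝ m R x) (hkm : k + 1 + 1 ≤ m) :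
    ContDiffAt ℝ k (hess R) x :=
  (contDiffAt_gradient hR hkm).fderiv_right le_rfl

lemma hasFDerivAt_gradient (hR : ContDiffAt ℝ 2 R x) : HasFDerivAt (∇ R) (hess R x) x :=
  ((contDiffAt_gradient hR (k := 1) (by norm_num)).differentiableAt one_ne_zero).hasFDerivAt

lemma hasFDerivAt_hess (hR : ContDiffAt ℝ 3 R x) :
    HasFDerivAt (hess R) (fderiv ℝ (hess R) x) x :=
  ((contDiffAt_hess hR (k := 1) (by norm_num)).differentiableAt one_ne_zero).hasFDerivAt

lemma inner_hess_apply (hR : ContDiffAt ℝ 2 R x) (u v : Eucl n) :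
    inner ℝ (hess R x u) v = fderiv ℝ (fderiv ℝ R) x u v := by
  have hfderiv : HasFDerivAt (fderiv ℝ R) (fderiv ℝ (fderiv ℝ R) x) x :=
    ((hR.fderiv_right (m := 1) (by norm_num)).differentiableAt one_ne_zero).hasFDerivAt
  have hgrad : HasFDerivAt (∇ R) _ x :=
    (InnerProductSpace.toDual ℝ (Eucl n)).symm.toContinuousLinearEquiv.hasFDerivAt.comp x hfderiv
  rw [hess, hgrad.fderiv]
  simp

lemma inner_hess_comm (hR : ContDiffAt ℝ 2 R x) (u v : Eucl n) :
    inner ℝ (hess R x u) v = inner ℝ u (hess R x v) := by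
  rw [real_inner_comm (hess R x v) u, inner_hess_apply hR, inner_hess_apply hR]
  exact hR.isSymmSndFDerivAt (by simp) u v

lemma inner_fderiv_hess_apply (hR : ContDiffAt ℝ 3 R x) (d : Eucl n) :
    inner ℝ d (fderiv ℝ (hess R) x d d) = iteratedFDeriv ℝ 3 R x fun _ => d := by
  have hquad : (fun y => iteratedFDeriv ℝ 2 R y fun _ => d) =ᶠ[𝓝 x]
      fun y => inner ℝ d (hess R y d) := by
    filter_upwards [hR.eventually (by simp)] with y hy
    rw [iteratedFDeriv_two_apply, ← inner_hess_apply (hy.of_le (by norm_num)), real_inner_comm]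
  have hleft : HasFDerivAt (fun y => iteratedFDeriv ℝ 2 R y fun _ => d) _ x :=
    (ContinuousMultilinearMap.apply ℝ (fun _ : Fin 2 => Eucl n) ℝ fun _ => d).hasFDerivAt.comp x
      (hR.differentiableAt_iteratedFDeriv (by norm_num)).hasFDerivAt
  have hright : HasFDerivAt (fun y => inner ℝ d (hess R y d)) _ x :=
    (innerSL ℝ d).hasFDerivAt.comp x
      ((ContinuousLinearMap.apply ℝ (Eucl n) d).hasFDerivAt.comp x (hasFDerivAt_hess hR))
  rw [iteratedFDeriv_succ_apply_left]
  exact DFunLike.congr_fun (hright.unique (hleft.congr_of_eventuallyEq hquad.symm)) d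

section Line

variable {s : ℝ}

lemma hasDerivAt_add_smul (x d : Eucl n) (s : ℝ) : HasDerivAt (fun s : ℝ => x + s • d) d s := by
  simpa using ((hasDerivAt_id s).smul_const d).const_add x

lemma hasDerivAt_line (hR : DifferentiableAt ℝ R (x + s • d)) :
    HasDerivAt (fun s : ℝ => R (x + s • d)) (inner ℝ (∇ R (x + s • d)) d) s := by
  have h := hR.hasGradientAt.hasFDerivAt.comp_hasDerivAt s (hasDerivAt_add_smul x d s)
  exact h

lemma hasDerivAt_inner_gradient_line (hR : ContDiffAt ℝ 2 R (x + s • d)) :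
    HasDerivAt (fun s : ℝ => inner ℝ (∇ R (x + s • d)) d)
      (inner ℝ d (hess R (x + s • d) d)) s := by
  have h := (innerSL ℝ d).hasFDerivAt.comp_hasDerivAt s
    ((hasFDerivAt_gradient hR).comp_hasDerivAt s (hasDerivAt_add_smul x d s))
  simpa [real_inner_comm d, Function.comp_def] using h

lemma hasDerivAt_inner_hess_line (hR : ContDiffAt ℝ 3 R (x + s • d)) :
    HasDerivAt (fun s : ℝ => inner ℝ d (hess R (x + s • d) d))
      (iteratedFDeriv ℝ 3 R (x + s • d) fun _ => d) s := by
  have h := (innerSL ℝ d).hasFDerivAt.comp_hasDerivAt s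
    ((ContinuousLinearMap.apply ℝ (Eucl n) d).hasFDerivAt.comp_hasDerivAt s
      ((hasFDerivAt_hess hR).comp_hasDerivAt s (hasDerivAt_add_smul x d s)))
  rw [← inner_fderiv_hess_apply hR]
  simpa [Function.comp_def] using h

end Line

lemma bregman_nonneg (hR : ConvexOn ℝ S R) (hx : x ∈ S) (hy : y ∈ S)
    (hd : DifferentiableAt ℝ R x) : 0 ≤ bregman R y x := by
  have h := add_fderiv_le_of_convexOn hR hx hy hd.hasGradientAt.hasFDerivAt
  rw [InnerProductSpace.toDual_apply_apply] at h
  unfold bregman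
  linarith

lemma inner_gradient_sub_nonneg (hR : ConvexOn ℝ S R) (hx : x ∈ S) (hy : y ∈ S)
    (hdx : DifferentiableAt ℝ R x) (hdy : DifferentiableAt ℝ R y) :
    0 ≤ inner ℝ (∇ R x - ∇ R y) (x - y) := by
  have hxy := bregman_nonneg hR hx hy hdx
  have hyx := bregman_nonneg hR hy hx hdy
  unfold bregman at hxy hyx
  rw [← neg_sub x y, inner_neg_right] at hxy
  rw [inner_sub_left]
  linarith

lemma inner_hess_nonneg (hR : ConvexOn ℝ S R) (hS : S ∈ 𝓝 x) (hx : ContDiffAt ℝ 2 R x)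
    (d : Eucl n) : 0 ≤ inner ℝ d (hess R x d) := by
  have hderiv : HasDerivAt (fun s : ℝ => inner ℝ (∇ R (x + s • d)) d)
      (inner ℝ d (hess R (x + (0 : ℝ) • d) d)) 0 :=
    hasDerivAt_inner_gradient_line (by simpa using hx)
  simp only [zero_smul, add_zero] at hderiv
  have hline : Tendsto (fun s : ℝ => x + s • d) (𝓝 0) (𝓝 x) :=
    Continuous.tendsto' (by fun_prop) 0 x (by simp)
  refine ge_of_tendsto hderiv.tendsto_slope_zero_right ?_
  filter_upwards [nhdsWithin_le_nhds (hline.eventually hS),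
    nhdsWithin_le_nhds (hline.eventually (hx.eventually (by simp))), self_mem_nhdsWithin]
    with s hsS hsd (hspos : 0 < s)
  have hmono := inner_gradient_sub_nonneg hR hsS (mem_of_mem_nhds hS)
    (hsd.differentiableAt two_ne_zero) (hx.differentiableAt two_ne_zero)
  rw [add_sub_cancel_left, inner_smul_right, inner_sub_left] at hmono
  simp only [zero_add, zero_smul, add_zero, smul_eq_mul]
  exact mul_nonneg (inv_nonneg.2 hspos.le) ((mul_nonneg_iff_of_pos_left hspos).1 hmono)

lemma mul_norm_sub_le_norm_gradient_sub (hR : ConvexOn ℝ S R) (hx : x ∈ S) (hy : y ∈ S)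
    (hdx : DifferentiableAt ℝ R x) (hdy : DifferentiableAt ℝ R y) (c : ℝ) :
    c * ‖x - y‖ ≤ ‖(c • x + ∇ R x) - (c • y + ∇ R y)‖ := by
  have hmono : c * ‖x - y‖ ^ 2 ≤
      inner ℝ ((c • x + ∇ R x) - (c • y + ∇ R y)) (x - y) := by
    have hsplit : (c • x + ∇ R x) - (c • y + ∇ R y) = c • (x - y) + (∇ R x - ∇ R y) := by module
    rw [hsplit, inner_add_left, real_inner_smul_left, real_inner_self_eq_norm_sq]
    linarith [inner_gradient_sub_nonneg hR hx hy hdx hdy]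
  have hcs := hmono.trans (real_inner_le_norm _ _)
  rcases (norm_nonneg (x - y)).eq_or_lt with h0 | hpos
  · rw [← h0, mul_zero]
    positivity
  · rw [pow_two, ← mul_assoc] at hcs
    exact le_of_mul_le_mul_right hcs hpos

end Hessian

/-! ### Self-concordant barriers -/

/-- The local norm `‖d‖ = (dᵀ (∇²R(x) + c I) d)^{1/2}` of the regularized function
`R + (c/2) ‖·‖²` at `x`. The algorithm uses it with `c = η β (t + 1)`; a positive `c` also spares
the case distinction on degenerate Hessians. -/
noncomputable def localNorm {n : ℕ} (R : Eucl n → ℝ) (c : ℝ) (x d : Eucl n) : ℝ :=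
  √(inner ℝ d (hess R x d) + c * ‖d‖ ^ 2)

lemma exists_first_exit {E : Type*} [TopologicalSpace E] {U : Set E} (hU : IsOpen U)
    {γ : ℝ → E} (hγ : Continuous γ) {a b : ℝ} (hab : a ≤ b) (ha : γ a ∈ U) (hb : γ b ∉ U) :
    ∃ c ∈ Ioc a b, (∀ s ∈ Ico a c, γ s ∈ U) ∧ γ c ∉ U := by
  have hclosed : IsClosed (Icc a b ∩ γ ⁻¹' Uᶜ) :=
    isClosed_Icc.inter (hU.isClosed_compl.preimage hγ)
  have hbdd : BddBelow (Icc a b ∩ γ ⁻¹' Uᶜ) := ⟨a, fun s hs => hs.1.1⟩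
  obtain ⟨⟨hac, hcb⟩, hc⟩ := hclosed.csInf_mem ⟨b, right_mem_Icc.2 hab, hb⟩ hbdd
  refine ⟨_, ⟨hac.lt_of_ne fun h => hc (h ▸ ha), hcb⟩, fun s hs => ?_, hc⟩
  by_contra hsU
  exact (csInf_le hbdd ⟨⟨hs.1, hs.2.le.trans hcb⟩, hsU⟩).not_gt hs.2

section Barrier

variable {n : ℕ} {ν : ℝ} {X : Set (Eucl n)} {R : Eucl n → ℝ}

namespace IsSelfConcordantBarrier

section Derivatives

variable {x : Eucl n}

lemma contDiffAt (hR : IsSelfConcordantBarrier ν X R) (hx : x ∈ interior X) :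
    ContDiffAt ℝ 3 R x :=
  hR.contDiffOn.contDiffAt (isOpen_interior.mem_nhds hx)

lemma contDiffAt_two (hR : IsSelfConcordantBarrier ν X R) (hx : x ∈ interior X) :
    ContDiffAt ℝ 2 R x :=
  (hR.contDiffAt hx).of_le (by norm_num)

lemma differentiableAt (hR : IsSelfConcordantBarrier ν X R) (hx : x ∈ interior X) :
    DifferentiableAt ℝ R x :=
  (hR.contDiffAt hx).differentiableAt three_ne_zero

lemma inner_hess_nonneg (hR : IsSelfConcordantBarrier ν X R) (hx : x ∈ interior X)
    (d : Eucl n) : 0 ≤ inner ℝ d (hess R x d) :=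
  EagerBandit.inner_hess_nonneg hR.convexOn (isOpen_interior.mem_nhds hx) (hR.contDiffAt_two hx) d

lemma continuousOn_gradient (hR : IsSelfConcordantBarrier ν X R) :
    ContinuousOn (∇ R) (interior X) := fun _ hx =>
  (contDiffAt_gradient (k := 0) (hR.contDiffAt hx) (by norm_num)).continuousAt.continuousWithinAt

lemma continuousOn_hess (hR : IsSelfConcordantBarrier ν X R) :
    ContinuousOn (hess R) (interior X) := fun _ hx =>
  (contDiffAt_hess (k := 0) (hR.contDiffAt hx) (by norm_num)).continuousAt.continuousWithinAt

end Derivatives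

section Line

variable {x d : Eucl n} {c s : ℝ}

lemma abs_third_le (hR : IsSelfConcordantBarrier ν X R) (hx : x ∈ interior X) (hc : 0 ≤ c) :
    |iteratedFDeriv ℝ 3 R x fun _ => d| ≤
      2 * (inner ℝ d (hess R x d) + c * ‖d‖ ^ 2) ^ (3 / 2 : ℝ) := by
  have := hR.inner_hess_nonneg hx d
  refine (hR.third_le x hx d).trans ?_
  gcongr
  exact le_add_of_nonneg_right (by positivity)

lemma inner_hess_add_pos (hR : IsSelfConcordantBarrier ν X R) (hx : x ∈ interior X)
    (hc : 0 < c) (hd : d ≠ 0) : 0 < inner ℝ d (hess R x d) + c * ‖d‖ ^ 2 :=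
  add_pos_of_nonneg_of_pos (hR.inner_hess_nonneg hx d) (by positivity)

lemma localNorm_line_le (hR : IsSelfConcordantBarrier ν X R) (hc : 0 < c) (hs : 0 ≤ s)
    (hmem : ∀ r ∈ Icc 0 s, x + r • d ∈ interior X) (hlt : s * localNorm R c x d < 1) :
    localNorm R c (x + s • d) d ≤ localNorm R c x d / (1 - s * localNorm R c x d) := by
  rcases eq_or_ne d 0 with rfl | hd
  · simp [localNorm]
  have h := sqrt_le_div_one_sub_of_selfConcordant hs
    (fun r hr => (hasDerivAt_inner_hess_line (hR.contDiffAt (hmem r hr))).add_const (c * ‖d‖ ^ 2))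
    (fun r hr => hR.inner_hess_add_pos (hmem r hr) hc hd)
    (fun r hr => hR.abs_third_le (hmem r hr) hc.le) (by simpa [localNorm] using hlt)
  simpa [localNorm] using h

lemma le_localNorm_line (hR : IsSelfConcordantBarrier ν X R) (hc : 0 < c) (hs : 0 ≤ s)
    (hmem : ∀ r ∈ Icc 0 s, x + r • d ∈ interior X) :
    localNorm R c x d / (1 + s * localNorm R c x d) ≤ localNorm R c (x + s • d) d := by
  rcases eq_or_ne d 0 with rfl | hd
  · simp [localNorm]
  have h := div_one_add_le_sqrt_of_selfConcordant hs
    (fun r hr => (hasDerivAt_inner_hess_line (hR.contDiffAt (hmem r hr))).add_const (c * ‖d‖ ^ 2))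
    (fun r hr => hR.inner_hess_add_pos (hmem r hr) hc hd)
    (fun r hr => hR.abs_third_le (hmem r hr) hc.le)
  simpa [localNorm] using h

lemma le_of_localNorm_lt_one (hR : IsSelfConcordantBarrier ν X R) (hc : 0 < c) (hs : s ∈ Icc 0 1)
    (hmem : ∀ r ∈ Icc 0 s, x + r • d ∈ interior X) (hlt : localNorm R c x d < 1) :
    R (x + s • d) ≤
      R x + |inner ℝ (∇ R x) d| + (localNorm R c x d / (1 - localNorm R c x d)) ^ 2 := by
  set a := localNorm R c x d
  have ha0 : 0 ≤ a := Real.sqrt_nonneg _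
  have hhess : ∀ r ∈ Icc 0 s, inner ℝ d (hess R (x + r • d) d) ≤ (a / (1 - a)) ^ 2 := by
    intro r hr
    have hra : r * a ≤ a := mul_le_of_le_one_left ha0 (hr.2.trans hs.2)
    have hlocal := hR.localNorm_line_le hc hr.1 (fun y hy => hmem y ⟨hy.1, hy.2.trans hr.2⟩)
      (hra.trans_lt hlt)
    calc inner ℝ d (hess R (x + r • d) d)
        ≤ inner ℝ d (hess R (x + r • d) d) + c * ‖d‖ ^ 2 := le_add_of_nonneg_right (by positivity)
      _ ≤ (a / (1 - r * a)) ^ 2 := (Real.sqrt_le_left (div_nonneg ha0 (by linarith))).1 hlocal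
      _ ≤ (a / (1 - a)) ^ 2 := by
        have : 0 < 1 - a := sub_pos.2 hlt
        have : 0 < 1 - r * a := by linarith
        gcongr
  have htaylor := le_quadratic_of_second_deriv_le hs.1
    (fun r hr => hasDerivAt_line (hR.differentiableAt (hmem r hr)))
    (fun r hr => hasDerivAt_inner_gradient_line (hR.contDiffAt_two (hmem r hr))) hhess
  simp only [zero_smul, add_zero] at htaylor
  have hlin : inner ℝ (∇ R x) d * s ≤ |inner ℝ (∇ R x) d| :=
    (mul_le_mul_of_nonneg_right (le_abs_self _) hs.1).trans
      (mul_le_of_le_one_right (abs_nonneg _) hs.2)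
  nlinarith [sq_nonneg (a / (1 - a)), pow_le_one₀ (n := 2) hs.1 hs.2]

-- The open Dikin ellipsoid: up to a first exit point the local norm, and so `R`, stays bounded.
theorem add_mem_interior (hR : IsSelfConcordantBarrier ν X R) (hx : x ∈ interior X)
    (hd : inner ℝ d (hess R x d) < 1) : x + d ∈ interior X := by
  by_contra hout
  have hcont : Continuous fun s : ℝ => x + s • d := by fun_prop
  obtain ⟨b, ⟨hb0, hb1⟩, hbefore, hexit⟩ := exists_first_exit isOpen_interior hcont zero_le_one
    (by simpa using hx) (by simpa using hout)
  have hnhds : Ico 0 b ∈ 𝓝[<] b := Ico_mem_nhdsLT hb0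
  have hlim : Tendsto (fun s : ℝ => x + s • d) (𝓝[<] b) (𝓝[interior X] (x + b • d)) :=
    tendsto_nhdsWithin_iff.2 ⟨hcont.continuousAt.mono_left nhdsWithin_le_nhds,
      mem_of_superset hnhds hbefore⟩
  have hfrontier : x + b • d ∈ frontier X :=
    ⟨closure_mono interior_subset (mem_closure_iff_nhdsWithin_neBot.2 hlim.neBot), hexit⟩
  obtain ⟨c, hc, hlt⟩ : ∃ c > 0, localNorm R c x d < 1 := by
    have hcont' : Tendsto (fun c => localNorm R c x d) (𝓝[>] 0) (𝓝 (localNorm R 0 x d)) :=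
      (Continuous.tendsto (by unfold localNorm; fun_prop) 0).mono_left nhdsWithin_le_nhds
    have hzero : localNorm R 0 x d < 1 := by
      rw [localNorm, zero_mul, add_zero]
      exact (Real.sqrt_lt' one_pos).2 (by simpa using hd)
    exact ((hcont'.eventually_lt_const hzero).and self_mem_nhdsWithin).exists.imp
      fun c hc => ⟨hc.2, hc.1⟩
  obtain ⟨s, hlarge, hs⟩ := ((((hR.tendsto_boundary _ hfrontier).comp hlim).eventually_gt_atTop
    (R x + |inner ℝ (∇ R x) d| + (localNorm R c x d / (1 - localNorm R c x d)) ^ 2)).and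
      hnhds).exists
  exact hlarge.not_ge (hR.le_of_localNorm_lt_one hc ⟨hs.1, hs.2.le.trans hb1⟩
    (fun r hr => hbefore r ⟨hr.1, hr.2.trans_lt hs.2⟩) hlt)

end Line

end IsSelfConcordantBarrier

end Barrier

/-! ### Minimizers, mixed Bregman divergences and prox-mappings -/

section Minimizers

variable {E α : Type*} [TopologicalSpace E] [LinearOrder α] [TopologicalSpace α]
  [OrderClosedTopology α] [NoMaxOrder α] {X : Set E} {g : E → α}

lemma isCompact_sublevel_interior (hX : IsCompact X) (hg : ContinuousOn g (interior X))
    (hfr : ∀ y ∈ frontier X, Tendsto g (𝓝[interior X] y) atTop) (a : α) :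
    IsCompact {y ∈ interior X | g y ≤ a} := by
  set K : Set E := {y ∈ interior X | g y ≤ a}
  have hKX : K ⊆ interior X := fun y hy => hy.1
  refine hX.of_isClosed_subset (isClosed_of_closure_subset fun y hy => ?_)
    (hKX.trans interior_subset)
  have : (𝓝[K] y).NeBot := mem_closure_iff_nhdsWithin_neBot.1 hy
  have hyi : y ∈ interior X := by
    by_contra hyi
    have hlim := (hfr y ⟨closure_mono (hKX.trans interior_subset) hy, hyi⟩).mono_left
      (nhdsWithin_mono y hKX)
    obtain ⟨w, hlarge, hw⟩ := ((hlim.eventually_gt_atTop a).and self_mem_nhdsWithin).exists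
    exact hlarge.not_ge hw.2
  exact ⟨hyi, le_of_tendsto (((hg y hyi).mono hKX).tendsto)
    (eventually_mem_nhdsWithin.mono fun _ hw => hw.2)⟩

lemma exists_isMinOn_interior (hX : IsCompact X) (hne : (interior X).Nonempty)
    (hg : ContinuousOn g (interior X))
    (hfr : ∀ y ∈ frontier X, Tendsto g (𝓝[interior X] y) atTop) :
    ∃ y ∈ interior X, IsMinOn g (interior X) y := by
  obtain ⟨y₀, hy₀⟩ := hne
  obtain ⟨y, hyK, hy⟩ := (isCompact_sublevel_interior hX hg hfr (g y₀)).exists_isMinOn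
    ⟨y₀, hy₀, le_rfl⟩ (hg.mono fun _ hy => hy.1)
  refine ⟨y, hyK.1, fun w hw => ?_⟩
  rcases le_total (g w) (g y₀) with h | h
  · exact hy ⟨hw, h⟩
  · exact hyK.2.trans h

end Minimizers

section Barrier

variable {n : ℕ} {ν : ℝ} {X : Set (Eucl n)} {R : Eucl n → ℝ}

lemma argmin_spec {S : Set (Eucl n)} {g : Eucl n → ℝ} (h : ∃ y ∈ S, IsMinOn g S y) :
    argmin S g ∈ S ∧ IsMinOn g S (argmin S g) :=
  Classical.epsilon_spec h

/-- The mixed Bregman divergence `D_R(x', x) + c / 2 ‖x' - x‖²` with curvature parameter `c`; the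
prox-mapping of round `t` is the one for `c = η β (t + 1)`. -/
noncomputable def mixedBregman (R : Eucl n → ℝ) (c : ℝ) (x' x : Eucl n) : ℝ :=
  bregman R x' x + c / 2 * ‖x' - x‖ ^ 2

lemma hasGradientAt_mixedBregman {y : Eucl n} (c : ℝ) (x : Eucl n)
    (hR : DifferentiableAt ℝ R y) :
    HasGradientAt (fun x' => mixedBregman R c x' x) (∇ R y - ∇ R x + c • (y - x)) y := by
  have hsub : HasFDerivAt (fun x' : Eucl n => x' - x) (ContinuousLinearMap.id ℝ (Eucl n)) y :=
    (hasFDerivAt_id y).sub_const x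
  have hinner := (innerSL ℝ (∇ R x)).hasFDerivAt.comp y hsub
  rw [hasGradientAt_iff_hasFDerivAt]
  refine (((hR.hasGradientAt.hasFDerivAt.sub_const (R x)).sub hinner).add
    (hsub.norm_sq.const_mul (c / 2))).congr_fderiv ?_
  ext w
  simp
  ring

lemma prox_eq_argmin_mixedBregman (X : Set (Eucl n)) (R : Eucl n → ℝ) (β : ℝ) (t : ℕ)
    (x v : Eucl n) (η : ℝ) :
    prox X R β t x v η = argmin (interior X) fun x' =>
      η * inner ℝ v (x - x') + mixedBregman R (η * β * (t + 1)) x' x := by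
  unfold prox mixedBregman
  congr! 2 with x'
  rw [norm_sub_rev x x']
  ring

namespace IsSelfConcordantBarrier

lemma sub_log_le_mixedBregman (hR : IsSelfConcordantBarrier ν X R) {c : ℝ} (hc : 0 < c)
    {x x' : Eucl n} (hx : x ∈ interior X) (hx' : x' ∈ interior X) :
    localNorm R c x (x' - x) - Real.log (1 + localNorm R c x (x' - x)) ≤
      mixedBregman R c x' x := by
  set d := x' - x with hd
  have hmem : ∀ s ∈ Icc (0 : ℝ) 1, x + s • d ∈ interior X := fun s hs =>
    hR.convexOn.1.add_smul_sub_mem hx hx' hs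
  have hquad : ∀ s : ℝ, HasDerivAt (fun s => c / 2 * ‖d‖ ^ 2 * s ^ 2) (c * ‖d‖ ^ 2 * s) s :=
    fun s => ((hasDerivAt_pow 2 s).const_mul _).congr_deriv (by norm_num; ring)
  have key := sub_log_one_add_le (Real.sqrt_nonneg _)
    (φ := fun s => R (x + s • d) + c / 2 * ‖d‖ ^ 2 * s ^ 2)
    (fun s hs => (hasDerivAt_line (hR.differentiableAt (hmem s hs))).add (hquad s))
    (fun s hs => (hasDerivAt_inner_gradient_line (hR.contDiffAt_two (hmem s hs))).add
      (((hasDerivAt_id s).const_mul (c * ‖d‖ ^ 2)).congr_deriv (mul_one _)))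
    (a := localNorm R c x d) (fun s hs => by
      have hnonneg := hR.inner_hess_nonneg (hmem s hs) d
      have hgrowth := hR.le_localNorm_line hc hs.1 fun r hr => hmem r ⟨hr.1, hr.2.trans hs.2⟩
      have hlocal : 0 ≤ localNorm R c x d := Real.sqrt_nonneg _
      have hpos : 0 ≤ localNorm R c x d / (1 + s * localNorm R c x d) :=
        div_nonneg hlocal (add_nonneg zero_le_one (mul_nonneg hs.1 hlocal))
      exact (Real.le_sqrt hpos (by positivity)).1 hgrowth)
  simp only [Pi.add_apply, one_smul, zero_smul, add_zero, one_pow, mul_one, ne_eq,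
    OfNat.ofNat_ne_zero, not_false_eq_true, zero_pow, mul_zero, id, hd, add_sub_cancel] at key
  unfold mixedBregman bregman
  linarith

lemma sub_le_log (hR : IsSelfConcordantBarrier ν X R) (hν : 0 ≤ ν) (hX : Convex ℝ X)
    {x p : Eucl n} (hx : x ∈ interior X) (hp : p ∈ X) {s : ℝ} (hs : s ∈ Ico (0 : ℝ) 1) :
    R (x + s • (p - x)) - R x ≤ ν * Real.log (1 / (1 - s)) := by
  have hmem : ∀ r ∈ Ico (0 : ℝ) 1, x + r • (p - x) ∈ interior X := fun r hr => by
    convert hX.add_smul_sub_mem_interior hp hx (t := 1 - r)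
      ⟨by linarith [hr.2], by linarith [hr.1]⟩ using 1
    module
  have key := sub_le_mul_log_of_sq_le hν
    (fun r hr => hasDerivAt_line (hR.differentiableAt (hmem r hr)))
    (fun r hr => hasDerivAt_inner_gradient_line (hR.contDiffAt_two (hmem r hr)))
    (fun r hr => by
      rw [← Real.sq_sqrt hν, ← Real.sq_sqrt (hR.inner_hess_nonneg (hmem r hr) (p - x)), ← mul_pow]
      exact sq_le_sq.2 ((hR.first_le _ (hmem r hr) (p - x)).trans (le_abs_self _))) hs
  simpa using key

section Prox

variable (hR : IsSelfConcordantBarrier ν X R) (hX : IsCompact X) (hne : (interior X).Nonempty)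
include hR hX hne

lemma exists_isMinOn_add {u : Eucl n → ℝ} (hu : Continuous u) :
    ∃ y ∈ interior X, IsMinOn (fun y => R y + u y) (interior X) y :=
  exists_isMinOn_interior hX hne (hR.contDiffOn.continuousOn.add hu.continuousOn) fun y hy =>
    (hR.tendsto_boundary y hy).atTop_add (hu.continuousAt.tendsto.mono_left nhdsWithin_le_nhds)

lemma argmin_spec : argmin (interior X) R ∈ interior X ∧
    IsMinOn R (interior X) (argmin (interior X) R) :=
  EagerBandit.argmin_spec
    (by simpa only [add_zero] using hR.exists_isMinOn_add hX hne (u := fun _ => 0) continuous_const)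

lemma gradient_argmin : ∇ R (argmin (interior X) R) = 0 := by
  obtain ⟨hmem, hmin⟩ := hR.argmin_spec hX hne
  simp [gradient, (hmin.isLocalMin (isOpen_interior.mem_nhds hmem)).fderiv_eq_zero]

variable (β : ℝ) (t : ℕ) (x v : Eucl n) (η : ℝ)

lemma prox_spec : prox X R β t x v η ∈ interior X ∧
    IsMinOn (fun x' => η * inner ℝ v (x - x') + mixedBregman R (η * β * (t + 1)) x' x)
      (interior X) (prox X R β t x v η) := by
  rw [prox_eq_argmin_mixedBregman]
  refine EagerBandit.argmin_spec ?_
  obtain ⟨y, hy, hmin⟩ := hR.exists_isMinOn_add hX hne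
    (u := fun x' => η * inner ℝ v (x - x') - R x - inner ℝ (∇ R x) (x' - x) +
      η * β * (t + 1) / 2 * ‖x' - x‖ ^ 2) (by fun_prop)
  refine ⟨y, hy, ?_⟩
  convert hmin using 2 with x'
  simp only [mixedBregman, bregman]
  ring

lemma smul_eq_of_prox : η • v = (η * β * (t + 1)) • (prox X R β t x v η - x) +
    (∇ R (prox X R β t x v η) - ∇ R x) := by
  obtain ⟨hmem, hmin⟩ := hR.prox_spec hX hne β t x v η
  set y := prox X R β t x v η
  have hlin : HasFDerivAt (fun x' => η * inner ℝ v (x - x')) (-(η • innerSL ℝ v)) y :=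
    (((innerSL ℝ v).hasFDerivAt.comp y ((hasFDerivAt_id y).const_sub x)).const_mul η).congr_fderiv
      (by ext w; simp)
  have hzero := (hmin.isLocalMin (isOpen_interior.mem_nhds hmem)).hasFDerivAt_eq_zero
    (hlin.add (hasGradientAt_mixedBregman _ x (hR.differentiableAt hmem)).hasFDerivAt)
  refine ext_inner_right ℝ fun w => ?_
  have hw := DFunLike.congr_fun hzero w
  simp only [add_apply, neg_apply, smul_apply, innerSL_apply_apply,
    InnerProductSpace.toDual_apply_apply, inner_add_left, smul_eq_mul, zero_apply] at hw
  rw [inner_add_left, real_inner_smul_left]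
  linarith

lemma continuous_prox {β : ℝ} {t : ℕ} {η : ℝ} (hc : 0 < η * β * (t + 1))
    {Z : Type*} [TopologicalSpace Z] {x v : Z → Eucl n} (hx : Continuous x)
    (hxX : ∀ ζ, x ζ ∈ interior X) (hv : Continuous v) :
    Continuous fun ζ => prox X R β t (x ζ) (v ζ) η := by
  set c := η * β * (t + 1)
  set w : Z → Eucl n := fun ζ => η • v ζ + c • x ζ + ∇ R (x ζ) with hw
  have hwc : Continuous w := by
    have : Continuous fun ζ => ∇ R (x ζ) := hR.continuousOn_gradient.comp_continuous hx hxX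
    fun_prop
  have hprox (ζ) : c • prox X R β t (x ζ) (v ζ) η + ∇ R (prox X R β t (x ζ) (v ζ) η) = w ζ := by
    simp only [hw, hR.smul_eq_of_prox hX hne β t (x ζ) (v ζ) η]
    module
  have hlip : ∀ ζ' ζ, ‖prox X R β t (x ζ') (v ζ') η - prox X R β t (x ζ) (v ζ) η‖ ≤
      ‖w ζ' - w ζ‖ / c := by
    intro ζ' ζ
    have hmem := fun ζ => (hR.prox_spec hX hne β t (x ζ) (v ζ) η).1
    rw [le_div_iff₀' hc, ← hprox, ← hprox]
    exact mul_norm_sub_le_norm_gradient_sub hR.convexOn (hmem ζ') (hmem ζ)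
      (hR.differentiableAt (hmem ζ')) (hR.differentiableAt (hmem ζ)) c
  refine continuous_iff_continuousAt.2 fun ζ => tendsto_iff_norm_sub_tendsto_zero.2 ?_
  refine squeeze_zero (fun _ => norm_nonneg _) (hlip · ζ) ?_
  simpa using (tendsto_iff_norm_sub_tendsto_zero.1 (hwc.tendsto ζ)).div_const c

end Prox

end IsSelfConcordantBarrier

end Barrier

/-! ### The Dikin ellipsoid and the single-shot estimator -/

section Matrix

variable {m : Type*} [Fintype m] [DecidableEq m] {B : Matrix m m ℝ}

lemma pos_of_mem_spectrum (hB : B.PosDef) {r : ℝ} (hr : r ∈ spectrum ℝ B) : 0 < r := by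
  obtain ⟨i, rfl⟩ := hB.1.spectrum_real_eq_range_eigenvalues ▸ hr
  exact hB.eigenvalues_pos i

lemma continuousOn_spectrum (B : Matrix m m ℝ) (f : ℝ → ℝ) : ContinuousOn f (spectrum ℝ B) :=
  Matrix.finite_real_spectrum.continuousOn f

lemma isHermitian_cfc (f : ℝ → ℝ) (B : Matrix m m ℝ) : (cfc f B).IsHermitian :=
  cfc_predicate (p := IsSelfAdjoint) f B

lemma isUnit_cfc_sqrt (hB : B.PosDef) : IsUnit (cfc Real.sqrt B) :=
  (isUnit_cfc_iff Real.sqrt B (continuousOn_spectrum B _) hB.1).2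
    fun _ hr => (Real.sqrt_pos.2 (pos_of_mem_spectrum hB hr)).ne'

lemma cfc_inv_sqrt (hB : B.PosDef) : cfc (fun r : ℝ => (√r)⁻¹) B = (cfc Real.sqrt B)⁻¹ := by
  rw [Matrix.nonsing_inv_eq_ringInverse]
  exact cfc_inv Real.sqrt B (fun _ hr => (Real.sqrt_pos.2 (pos_of_mem_spectrum hB hr)).ne')
    (continuousOn_spectrum B _) hB.1

lemma cfc_sqrt_mul_cfc_sqrt (hB : B.PosDef) : cfc Real.sqrt B * cfc Real.sqrt B = B := by
  have hsa : IsSelfAdjoint B := hB.1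
  rw [← cfc_mul _ _ B (continuousOn_spectrum B _) (continuousOn_spectrum B _)]
  conv_rhs => rw [← cfc_id' ℝ B]
  exact cfc_congr fun r hr => Real.mul_self_sqrt (pos_of_mem_spectrum hB hr).le

open scoped Matrix.Norms.L2Operator in
lemma continuous_cfc_of_posDef {Z : Type*} [TopologicalSpace Z] {B : Z → Matrix m m ℝ}
    (hBc : Continuous B) (hB : ∀ ζ, (B ζ).PosDef) {f : ℝ → ℝ} (hf : ContinuousOn f (Ioi 0)) :
    Continuous fun ζ => cfc f (B ζ) :=
  hBc.cfc_of_mem_nhdsSet f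
    (isOpen_Ioi.mem_nhdsSet.2 (iUnion_subset fun ζ _ => pos_of_mem_spectrum (hB ζ)))
    (fun ζ => (hB ζ).1) hf

end Matrix

section Euclidean

variable {n : ℕ}

lemma inner_toEuclideanCLM_comm {A : Matrix (Fin n) (Fin n) ℝ} (hA : A.IsHermitian)
    (u v : Eucl n) : inner ℝ (Matrix.toEuclideanCLM (𝕜 := ℝ) A u) v =
      inner ℝ u (Matrix.toEuclideanCLM (𝕜 := ℝ) A v) := by
  have h : IsSelfAdjoint (Matrix.toEuclideanCLM (n := Fin n) (𝕜 := ℝ) A) :=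
    IsSelfAdjoint.map (R := Matrix (Fin n) (Fin n) ℝ) hA _
  exact ContinuousLinearMap.isSelfAdjoint_iff_isSymmetric.1 h u v

lemma continuous_toEuclideanCLM_apply {Z : Type*} [TopologicalSpace Z]
    {A : Z → Matrix (Fin n) (Fin n) ℝ} {v : Z → Eucl n} (hA : Continuous A) (hv : Continuous v) :
    Continuous fun ζ => Matrix.toEuclideanCLM (𝕜 := ℝ) (A ζ) (v ζ) :=
  ((LinearMap.continuous_of_finiteDimensional (Matrix.toEuclideanCLM
    (n := Fin n) (𝕜 := ℝ)).toAlgEquiv.toLinearMap).comp hA).clm_apply hv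

lemma toEuclideanCLM_hessMatrix (R : Eucl n → ℝ) (x : Eucl n) :
    Matrix.toEuclideanCLM (𝕜 := ℝ) (hessMatrix R x) = hess R x :=
  StarAlgEquiv.apply_symm_apply _ _

end Euclidean

section Barrier

variable {n : ℕ} {ν : ℝ} {X : Set (Eucl n)} {R : Eucl n → ℝ}

namespace IsSelfConcordantBarrier

lemma posSemidef_hessMatrix (hR : IsSelfConcordantBarrier ν X R) {x : Eucl n}
    (hx : x ∈ interior X) : (hessMatrix R x).PosSemidef := by
  have hsa : IsSelfAdjoint (hess R x) :=
    ContinuousLinearMap.isSelfAdjoint_iff_isSymmetric.2 fun u v =>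
      inner_hess_comm (hR.contDiffAt_two hx) u v
  have hsymm : (hessMatrix R x).IsHermitian :=
    EquivLike.injective (Matrix.toEuclideanCLM (n := Fin n) (𝕜 := ℝ)) <| by
      rw [← Matrix.star_eq_conjTranspose, map_star, toEuclideanCLM_hessMatrix, hsa.star_eq]
  refine Matrix.PosSemidef.of_dotProduct_mulVec_nonneg hsymm fun v => ?_
  have hnonneg := hR.inner_hess_nonneg hx (WithLp.toLp 2 v)
  rw [← toEuclideanCLM_hessMatrix, Matrix.inner_toEuclideanCLM] at hnonneg
  simpa using hnonneg

lemma posDef_hessMatrix_add (hR : IsSelfConcordantBarrier ν X R) {x : Eucl n}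
    (hx : x ∈ interior X) {c : ℝ} (hc : 0 < c) : (hessMatrix R x + c • 1).PosDef :=
  Matrix.PosDef.posSemidef_add (hR.posSemidef_hessMatrix hx) (Matrix.PosDef.one.smul hc)

section Scaling

variable {β η : ℝ} {t : ℕ} {x : Eucl n} (hR : IsSelfConcordantBarrier ν X R)
  (hc : 0 < η * β * (t + 1))

section
include hR hc

lemma scaling_inv (hx : x ∈ interior X) : (scaling R β t x η)⁻¹ =
    cfc Real.sqrt (hessMatrix R x + (η * β * (t + 1)) • 1) := by
  have hB := hR.posDef_hessMatrix_add hx hc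
  rw [scaling, cfc_inv_sqrt hB,
    Matrix.nonsing_inv_nonsing_inv _ ((Matrix.isUnit_iff_isUnit_det _).1 (isUnit_cfc_sqrt hB))]

lemma isUnit_scaling (hx : x ∈ interior X) : IsUnit (scaling R β t x η) := by
  have hB := hR.posDef_hessMatrix_add hx hc
  rw [scaling, cfc_inv_sqrt hB]
  exact Matrix.isUnit_nonsing_inv_iff.2 (isUnit_cfc_sqrt hB)

lemma scaling_inv_apply_scaling (hx : x ∈ interior X) (v : Eucl n) :
    Matrix.toEuclideanCLM (𝕜 := ℝ) (scaling R β t x η)⁻¹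
      (Matrix.toEuclideanCLM (𝕜 := ℝ) (scaling R β t x η) v) = v := by
  rw [← mul_apply_eq_comp, ← map_mul, Matrix.nonsing_inv_mul _
    ((Matrix.isUnit_iff_isUnit_det _).1 (hR.isUnit_scaling hc hx)), map_one, one_apply_eq_self]

lemma scaling_apply_scaling_inv (hx : x ∈ interior X) (v : Eucl n) :
    Matrix.toEuclideanCLM (𝕜 := ℝ) (scaling R β t x η)
      (Matrix.toEuclideanCLM (𝕜 := ℝ) (scaling R β t x η)⁻¹ v) = v := by
  rw [← mul_apply_eq_comp, ← map_mul, Matrix.mul_nonsing_inv _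
    ((Matrix.isUnit_iff_isUnit_det _).1 (hR.isUnit_scaling hc hx)), map_one, one_apply_eq_self]

lemma norm_scaling_inv (hx : x ∈ interior X) (d : Eucl n) :
    ‖Matrix.toEuclideanCLM (𝕜 := ℝ) (scaling R β t x η)⁻¹ d‖ =
      localNorm R (η * β * (t + 1)) x d := by
  rw [localNorm, ← Real.sqrt_sq (norm_nonneg (Matrix.toEuclideanCLM (𝕜 := ℝ) _ d)),
    ← real_inner_self_eq_norm_sq, hR.scaling_inv hc hx,
    inner_toEuclideanCLM_comm (isHermitian_cfc _ _), ← mul_apply_eq_comp, ← map_mul,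
    cfc_sqrt_mul_cfc_sqrt (hR.posDef_hessMatrix_add hx hc), map_add, toEuclideanCLM_hessMatrix,
    map_smul, map_one]
  simp [inner_add_right, inner_smul_right]

lemma localNorm_scaling (hx : x ∈ interior X) (z : Eucl n) :
    localNorm R (η * β * (t + 1)) x (Matrix.toEuclideanCLM (𝕜 := ℝ) (scaling R β t x η) z) =
      ‖z‖ := by
  rw [← hR.norm_scaling_inv hc hx, hR.scaling_inv_apply_scaling hc hx]

lemma norm_scaling_sq_le (hx : x ∈ interior X) {z : Eucl n} (hz : ‖z‖ ≤ 1) :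
    ‖Matrix.toEuclideanCLM (𝕜 := ℝ) (scaling R β t x η) z‖ ^ 2 ≤ 1 / (η * β * (t + 1)) := by
  have hlocal := (Real.sqrt_le_one).1 ((hR.localNorm_scaling hc hx z).trans_le hz)
  have hnonneg := hR.inner_hess_nonneg hx (Matrix.toEuclideanCLM (𝕜 := ℝ) (scaling R β t x η) z)
  rw [le_div_iff₀' hc]
  linarith

lemma play_mem_interior (hx : x ∈ interior X) {z : Eucl n} (hz : ‖z‖ ≤ 1) :
    play R β t x z η ∈ interior X := by
  refine hR.add_mem_interior hx ?_
  set d := Matrix.toEuclideanCLM (𝕜 := ℝ) (scaling R β t x η) z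
  have hlocal := (Real.sqrt_le_one).1 ((hR.localNorm_scaling hc hx z).trans_le hz)
  rcases eq_or_ne d 0 with hd | hd
  · simp [hd]
  · exact (lt_add_of_pos_right _ (by positivity)).trans_le hlocal

variable {Z : Type*} [TopologicalSpace Z] {y : Z → Eucl n} (hy : Continuous y)
  (hyX : ∀ ζ, y ζ ∈ interior X)
include hy hyX

omit hc in
lemma continuous_hessMatrix_comp : Continuous fun ζ => hessMatrix R (y ζ) :=
  (LinearMap.continuous_of_finiteDimensional (Matrix.toEuclideanCLM
    (n := Fin n) (𝕜 := ℝ)).symm.toAlgEquiv.toLinearMap).comp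
      (hR.continuousOn_hess.comp_continuous hy hyX)

lemma continuous_scaling_inv : Continuous fun ζ => (scaling R β t (y ζ) η)⁻¹ := by
  simp only [fun ζ => hR.scaling_inv hc (hyX ζ)]
  exact continuous_cfc_of_posDef ((hR.continuous_hessMatrix_comp hy hyX).add continuous_const)
    (fun ζ => hR.posDef_hessMatrix_add (hyX ζ) hc) Real.continuous_sqrt.continuousOn

lemma continuous_scaling : Continuous fun ζ => scaling R β t (y ζ) η :=
  continuous_cfc_of_posDef ((hR.continuous_hessMatrix_comp hy hyX).add continuous_const)
    (fun ζ => hR.posDef_hessMatrix_add (hyX ζ) hc)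
    (Real.continuous_sqrt.continuousOn.inv₀ fun _ hr => (Real.sqrt_pos.2 hr).ne')

lemma continuous_play {z : Z → Eucl n} (hz : Continuous z) :
    Continuous fun ζ => play R β t (y ζ) (z ζ) η :=
  hy.add (continuous_toEuclideanCLM_apply (hR.continuous_scaling hc hy hyX) hz)

lemma continuous_gradEst {z : Z → Eucl n} (hz : Continuous z) (hz1 : ∀ ζ, ‖z ζ‖ ≤ 1)
    {f : Eucl n → ℝ} (hf : ContinuousOn f (interior X)) :
    Continuous fun ζ => gradEst R β t f (y ζ) (z ζ) η :=
  (continuous_const.mul (hf.comp_continuous (hR.continuous_play hc hy hyX hz)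
    fun ζ => hR.play_mem_interior hc (hyX ζ) (hz1 ζ))).smul
      (continuous_toEuclideanCLM_apply (hR.continuous_scaling_inv hc hy hyX) hz)

end

end Scaling

end IsSelfConcordantBarrier

end Barrier

/-! ### The divergence theorem on the unit ball -/

/-- Smooth decreasing cutoffs with value `1` on `(-∞, k / (k + 1)]` and `0` on `[1, ∞)`. As
functions of `‖w‖ ^ 2` they approximate the indicator function of the unit ball. -/
noncomputable def radialCutoff (k : ℕ) (ρ : ℝ) : ℝ :=
  Real.smoothTransition (((k : ℝ) + 1) * (1 - ρ))

lemma contDiff_radialCutoff (k : ℕ) : ContDiff ℝ 1 (radialCutoff k) :=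
  (Real.smoothTransition.contDiff (n := 1)).comp (by fun_prop)

lemma antitone_radialCutoff (k : ℕ) : Antitone (radialCutoff k) := fun _ _ h =>
  Real.smoothTransition.monotone (by gcongr)

lemma radialCutoff_of_one_le (k : ℕ) {ρ : ℝ} (hρ : 1 ≤ ρ) : radialCutoff k ρ = 0 :=
  Real.smoothTransition.zero_of_nonpos
    (mul_nonpos_of_nonneg_of_nonpos (by positivity) (by linarith))

lemma radialCutoff_of_one_le_mul {k : ℕ} {ρ : ℝ} (hρ : 1 ≤ ((k : ℝ) + 1) * (1 - ρ)) :
    radialCutoff k ρ = 1 :=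
  Real.smoothTransition.one_of_one_le hρ

lemma eventually_one_lt_mul {δ : ℝ} (hδ : 0 < δ) : ∀ᶠ k : ℕ in atTop, 1 < ((k : ℝ) + 1) * δ :=
  ((tendsto_atTop_add_const_right _ 1 tendsto_natCast_atTop_atTop).atTop_mul_const
    hδ).eventually_gt_atTop 1

lemma tendsto_radialCutoff_norm_sq {E : Type*} [SeminormedAddCommGroup E] (w : E) :
    Tendsto (fun k => radialCutoff k (‖w‖ ^ 2)) atTop
      (𝓝 ((Metric.ball (0 : E) 1).indicator 1 w)) := by
  by_cases hw : w ∈ Metric.ball (0 : E) 1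
  · rw [indicator_of_mem hw]
    have hlt : ‖w‖ ^ 2 < 1 := pow_lt_one₀ (norm_nonneg w) (mem_ball_zero_iff.1 hw) two_ne_zero
    refine tendsto_const_nhds.congr' ?_
    filter_upwards [eventually_one_lt_mul (sub_pos.2 hlt)] with k hk
    exact (radialCutoff_of_one_le_mul hk.le).symm
  · rw [indicator_of_notMem hw]
    have hle : 1 ≤ ‖w‖ ^ 2 := one_le_pow₀ (not_lt.1 fun h => hw (mem_ball_zero_iff.2 h))
    exact tendsto_const_nhds.congr fun k => (radialCutoff_of_one_le k hle).symm

lemma deriv_radialCutoff_of_one_lt (k : ℕ) {ρ : ℝ} (hρ : 1 < ρ) :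
    deriv (radialCutoff k) ρ = 0 := by
  have h : radialCutoff k =ᶠ[𝓝 ρ] fun _ => 0 := by
    filter_upwards [Ioi_mem_nhds hρ] with s hs using radialCutoff_of_one_le k (le_of_lt hs)
  rw [h.deriv_eq, deriv_const]

lemma deriv_radialCutoff_of_one_lt_mul {k : ℕ} {ρ : ℝ} (hρ : 1 < ((k : ℝ) + 1) * (1 - ρ)) :
    deriv (radialCutoff k) ρ = 0 := by
  have h : radialCutoff k =ᶠ[𝓝 ρ] fun _ => 1 := by
    filter_upwards [(by fun_prop : Continuous fun ρ : ℝ =>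
      ((k : ℝ) + 1) * (1 - ρ)).continuousAt.eventually_const_lt hρ] with s hs
      using radialCutoff_of_one_le_mul hs.le
  rw [h.deriv_eq, deriv_const]

lemma continuous_deriv_radialCutoff (k : ℕ) : Continuous (deriv (radialCutoff k)) :=
  (contDiff_radialCutoff k).continuous_deriv le_rfl

lemma hasDerivAt_radialCutoff (k : ℕ) (ρ : ℝ) :
    HasDerivAt (radialCutoff k) (deriv (radialCutoff k) ρ) ρ :=
  ((contDiff_radialCutoff k).differentiable one_ne_zero).differentiableAt.hasDerivAt

lemma integral_deriv_radialCutoff_sq (k : ℕ) :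
    ∫ r in Ioc (0 : ℝ) 1, -(deriv (radialCutoff k) (r ^ 2) * (2 * r)) = 1 := by
  have hderiv (r : ℝ) : HasDerivAt (fun r : ℝ => radialCutoff k (r ^ 2))
      (deriv (radialCutoff k) (r ^ 2) * (2 * r)) r := by
    simpa [Function.comp_def] using
      (hasDerivAt_radialCutoff k (r ^ 2)).comp r (hasDerivAt_pow 2 r)
  have hcont := continuous_deriv_radialCutoff k
  rw [integral_neg, ← intervalIntegral.integral_of_le zero_le_one,
    intervalIntegral.integral_eq_sub_of_hasDerivAt (fun r _ => hderiv r)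
      ((by fun_prop : Continuous fun r : ℝ =>
        deriv (radialCutoff k) (r ^ 2) * (2 * r)).intervalIntegrable _ _),
    one_pow, radialCutoff_of_one_le k le_rfl, zero_pow two_ne_zero,
    radialCutoff_of_one_le_mul (by simp)]
  norm_num

-- The derivatives of the cutoffs form an approximate identity at `1`.
lemma tendsto_integral_deriv_radialCutoff_mul {g : ℝ → ℝ} (hg : ContinuousOn g (Icc 0 1)) :
    Tendsto (fun k : ℕ => ∫ r in Ioc (0 : ℝ) 1,
      -(deriv (radialCutoff k) (r ^ 2) * (2 * r)) * g r) atTop (𝓝 (g 1)) := by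
  refine tendsto_setIntegral_peak_smul_of_integrableOn_of_tendsto measurableSet_Ioc
    measurableSet_Ioc subset_rfl self_mem_nhdsWithin measure_Ioc_lt_top.ne
    (Eventually.of_forall fun k r hr => ?_) (fun u hu h1u => ?_)
    (by simp only [integral_deriv_radialCutoff_sq, tendsto_const_nhds])
    (Eventually.of_forall fun k => ?_) (hg.integrableOn_Icc.mono_set Ioc_subset_Icc_self)
    ((hg 1 (right_mem_Icc.2 zero_le_one)).tendsto.mono_left
      (nhdsWithin_mono _ Ioc_subset_Icc_self))
  · exact neg_nonneg.2 (mul_nonpos_of_nonpos_of_nonneg (antitone_radialCutoff k).deriv_nonpos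
      (mul_nonneg zero_le_two hr.1.le))
  · obtain ⟨a, ha, hau⟩ := exists_Ioc_subset_of_mem_nhds (hu.mem_nhds h1u) ⟨0, zero_lt_one⟩
    rw [Metric.tendstoUniformlyOn_iff]
    intro ε hε
    filter_upwards [eventually_one_lt_mul (sub_pos.2 ha)] with k hk r hr
    have hra : r ≤ a := not_lt.1 fun h => hr.2 (hau ⟨h, hr.1.2⟩)
    have hsq : r ^ 2 ≤ a := by nlinarith [hr.1.1, hr.1.2]
    have hk' : 1 < ((k : ℝ) + 1) * (1 - r ^ 2) := hk.trans_le (by gcongr)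
    simpa [deriv_radialCutoff_of_one_lt_mul hk'] using hε
  · have hcont := continuous_deriv_radialCutoff k
    exact (by fun_prop : Continuous fun r : ℝ =>
      -(deriv (radialCutoff k) (r ^ 2) * (2 * r))).aestronglyMeasurable

lemma fderiv_radialCutoff_norm_sq {E : Type*} [NormedAddCommGroup E] [InnerProductSpace ℝ E]
    (k : ℕ) (w u : E) :
    fderiv ℝ (fun w : E => radialCutoff k (‖w‖ ^ 2)) w u =
      deriv (radialCutoff k) (‖w‖ ^ 2) * (2 * inner ℝ w u) := by
  have h := (hasDerivAt_radialCutoff k (‖w‖ ^ 2)).comp_hasFDerivAt w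
    (hasStrictFDerivAt_norm_sq w).hasFDerivAt
  rw [Function.comp_def] at h
  simp [h.fderiv]

section Divergence

variable {E : Type*} [NormedAddCommGroup E]

lemma integrable_mul_of_support_subset_closedBall [NormedSpace ℝ E] [FiniteDimensional ℝ E]
    [MeasurableSpace E] [BorelSpace E] {μ : Measure E} [IsFiniteMeasureOnCompacts μ] {g c : E → ℝ}
    (hg : ContinuousOn g (Metric.closedBall 0 1)) (hc : Continuous c)
    (hsupp : Function.support c ⊆ Metric.closedBall 0 1) :
    Integrable (fun w => g w * c w) μ :=
  (integrableOn_iff_integrable_of_support_subset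
    ((Function.support_mul_subset_right g c).trans hsupp)).1
    ((hg.mul hc.continuousOn).integrableOn_compact (isCompact_closedBall 0 1))

lemma support_radialCutoff_norm_sq_subset (k : ℕ) :
    Function.support (fun w : E => radialCutoff k (‖w‖ ^ 2)) ⊆ Metric.closedBall 0 1 := by
  intro w hw
  by_contra hw1
  rw [mem_closedBall_zero_iff, not_le] at hw1
  exact hw (radialCutoff_of_one_le k (one_le_pow₀ hw1.le))

variable [InnerProductSpace ℝ E] [FiniteDimensional ℝ E] [MeasurableSpace E] [BorelSpace E]

lemma tendsto_integral_mul_radialCutoff {μ : Measure E} [IsFiniteMeasureOnCompacts μ] {h : E → ℝ}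
    (hh : ContinuousOn h (Metric.closedBall 0 1)) :
    Tendsto (fun k => ∫ w, h w * radialCutoff k (‖w‖ ^ 2) ∂μ) atTop
      (𝓝 (∫ w in Metric.ball (0 : E) 1, h w ∂μ)) := by
  have hball : ∫ w in Metric.ball (0 : E) 1, h w ∂μ =
      ∫ w in Metric.closedBall (0 : E) 1, h w * (Metric.ball (0 : E) 1).indicator 1 w ∂μ := by
    rw [← inter_eq_self_of_subset_right (Metric.ball_subset_closedBall (x := (0 : E)) (ε := 1)),
      ← setIntegral_indicator measurableSet_ball]
    simp only [inter_eq_self_of_subset_right Metric.ball_subset_closedBall,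
      ← indicator_mul_right _ h, Pi.one_apply, mul_one]
  have hrestrict (k : ℕ) : ∫ w, h w * radialCutoff k (‖w‖ ^ 2) ∂μ =
      ∫ w in Metric.closedBall (0 : E) 1, h w * radialCutoff k (‖w‖ ^ 2) ∂μ :=
    (setIntegral_eq_integral_of_forall_compl_eq_zero fun w hw => by
      rw [Function.notMem_support.1 fun hs => hw (support_radialCutoff_norm_sq_subset k hs),
        mul_zero]).symm
  simp only [hball, hrestrict]
  have hint := hh.integrableOn_compact (μ := μ) (isCompact_closedBall 0 1)
  refine tendsto_integral_of_dominated_convergence (fun w => ‖h w‖) (fun k => ?_) hint.norm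
    (fun k => Eventually.of_forall fun w => ?_)
    (Eventually.of_forall fun w => (tendsto_radialCutoff_norm_sq w).const_mul _)
  · have hcont := (contDiff_radialCutoff k).continuous
    exact hint.aestronglyMeasurable.mul
      (by fun_prop : Continuous fun w : E => radialCutoff k (‖w‖ ^ 2)).aestronglyMeasurable
  · rw [norm_mul, radialCutoff, Real.norm_of_nonneg (Real.smoothTransition.nonneg _)]
    exact mul_le_of_le_one_right (norm_nonneg _) (Real.smoothTransition.le_one _)

lemma integral_polar [Nontrivial E] (μ : Measure E) [μ.IsAddHaarMeasure] {F : E → ℝ}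
    (hF : Integrable F μ) :
    ∫ w, F w ∂μ = ∫ r in Ioi (0 : ℝ), r ^ (Module.finrank ℝ E - 1) *
      ∫ z : Metric.sphere (0 : E) 1, F (r • (z : E)) ∂μ.toSphere := by
  set d := Module.finrank ℝ E - 1
  have hmp := μ.measurePreserving_homeomorphUnitSphereProd
  have hemb := (homeomorphUnitSphereProd E).measurableEmbedding
  have hfun (x : ({0}ᶜ : Set E)) : F (((homeomorphUnitSphereProd E x).2 : ℝ) •
      ((homeomorphUnitSphereProd E x).1 : E)) = F x := by
    have hx : ‖(x : E)‖ ≠ 0 := norm_ne_zero_iff.2 x.2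
    simp [smul_smul, hx]
  have hcomp : ∫ w, F w ∂μ = ∫ p : Metric.sphere (0 : E) 1 × Ioi (0 : ℝ),
      F ((p.2 : ℝ) • (p.1 : E)) ∂μ.toSphere.prod (.volumeIoiPow d) := by
    rw [← hmp.integral_comp hemb]
    simp only [hfun]
    rw [integral_subtype_comap (measurableSet_singleton _).compl fun x => F x,
      restrict_compl_singleton]
  have hint : Integrable (fun p : Metric.sphere (0 : E) 1 × Ioi (0 : ℝ) =>
      F ((p.2 : ℝ) • (p.1 : E))) (μ.toSphere.prod (.volumeIoiPow d)) := by
    rw [← hmp.integrable_comp_emb hemb, Function.comp_def]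
    simp only [hfun]
    rw [← Function.comp_def F, ← integrableOn_iff_comap_subtypeVal
      (measurableSet_singleton _).compl]
    exact hF.integrableOn
  rw [hcomp, integral_prod_symm _ hint]
  simp only [Measure.volumeIoiPow, ENNReal.ofReal]
  rw [integral_withDensity_eq_integral_smul ((measurable_subtype_coe.pow_const _).real_toNNReal),
    integral_subtype_comap measurableSet_Ioi fun r : ℝ => Real.toNNReal (r ^ d) •
      ∫ z : Metric.sphere (0 : E) 1, F (r • (z : E)) ∂μ.toSphere]
  refine setIntegral_congr_fun measurableSet_Ioi fun r hr => ?_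
  simp only [NNReal.smul_def, Real.coe_toNNReal _ (pow_nonneg (le_of_lt hr) _), smul_eq_mul]

lemma continuousOn_integral_sphere {μ : Measure E} [μ.IsAddHaarMeasure] {g : E → ℝ}
    (hg : ContinuousOn g (Metric.closedBall 0 1)) (u : E) :
    ContinuousOn (fun r : ℝ =>
      ∫ z : Metric.sphere (0 : E) 1, g (r • (z : E)) * inner ℝ (z : E) u ∂μ.toSphere)
      (Icc 0 1) := by
  obtain ⟨C, hC⟩ := (isCompact_closedBall (0 : E) 1).exists_bound_of_continuousOn hg
  have hmem {r : ℝ} (hr : r ∈ Icc (0 : ℝ) 1) (z : Metric.sphere (0 : E) 1) :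
      r • (z : E) ∈ Metric.closedBall (0 : E) 1 := by
    simpa [norm_smul, abs_of_nonneg hr.1] using hr.2
  refine continuousOn_of_dominated (bound := fun _ => C * ‖u‖) (fun r hr => ?_)
    (fun r hr => Eventually.of_forall fun z => ?_) (integrable_const _)
    (Eventually.of_forall fun z => (hg.comp (by fun_prop) fun r hr => hmem hr z).mul
      continuousOn_const)
  · exact ((hg.comp_continuous (by fun_prop) (hmem hr)).mul
      (by fun_prop)).aestronglyMeasurable
  · rw [norm_mul]
    gcongr
    · exact (norm_nonneg _).trans (hC _ (hmem hr z))
    · exact hC _ (hmem hr z)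
    · simpa using norm_inner_le_norm (𝕜 := ℝ) (z : E) u

lemma integrable_mul_fderiv_radialCutoff {μ : Measure E} [IsFiniteMeasureOnCompacts μ] {g : E → ℝ}
    (hg : ContinuousOn g (Metric.closedBall 0 1)) (u : E) (k : ℕ) :
    Integrable (fun w => g w * fderiv ℝ (fun w : E => radialCutoff k (‖w‖ ^ 2)) w u) μ := by
  have hcont := continuous_deriv_radialCutoff k
  simp only [fderiv_radialCutoff_norm_sq]
  refine integrable_mul_of_support_subset_closedBall hg (by fun_prop) fun w hw => ?_
  by_contra hw1
  rw [mem_closedBall_zero_iff, not_le] at hw1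
  exact hw (by simp [deriv_radialCutoff_of_one_lt k (one_lt_pow₀ hw1 two_ne_zero)])

lemma integral_mul_fderiv_radialCutoff [Nontrivial E] (μ : Measure E) [μ.IsAddHaarMeasure]
    {g : E → ℝ} (hg : ContinuousOn g (Metric.closedBall 0 1)) (u : E) (k : ℕ) :
    ∫ w, g w * fderiv ℝ (fun w : E => radialCutoff k (‖w‖ ^ 2)) w u ∂μ =
      -∫ r in Ioc (0 : ℝ) 1, -(deriv (radialCutoff k) (r ^ 2) * (2 * r)) *
        (r ^ (Module.finrank ℝ E - 1) *
          ∫ z : Metric.sphere (0 : E) 1, g (r • (z : E)) * inner ℝ (z : E) u ∂μ.toSphere) := by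
  have hsphere (r : ℝ) : ∫ z : Metric.sphere (0 : E) 1, g (r • (z : E)) *
      fderiv ℝ (fun w : E => radialCutoff k (‖w‖ ^ 2)) (r • (z : E)) u ∂μ.toSphere =
      deriv (radialCutoff k) (r ^ 2) * (2 * r) *
        ∫ z : Metric.sphere (0 : E) 1, g (r • (z : E)) * inner ℝ (z : E) u ∂μ.toSphere := by
    rw [← integral_const_mul]
    refine integral_congr_ae (Eventually.of_forall fun z => ?_)
    simp only [fderiv_radialCutoff_norm_sq, norm_smul, norm_eq_of_mem_sphere, mul_one,
      Real.norm_eq_abs, sq_abs, real_inner_smul_left]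
    ring
  rw [integral_polar μ (integrable_mul_fderiv_radialCutoff hg u k), ← integral_neg]
  simp only [hsphere]
  refine (setIntegral_eq_of_subset_of_forall_sdiff_eq_zero measurableSet_Ioi Ioc_subset_Ioi_self
    fun r hr => ?_).trans (setIntegral_congr_fun measurableSet_Ioc fun r _ => by ring)
  have hr1 : 1 < r := not_le.1 fun h => hr.2 ⟨hr.1, h⟩
  simp [deriv_radialCutoff_of_one_lt k (one_lt_pow₀ hr1 two_ne_zero)]

lemma integral_mul_fderiv_radialCutoff_eq_neg {μ : Measure E} [μ.IsAddHaarMeasure] {g : E → ℝ}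
    (hg : ∀ w ∈ Metric.closedBall (0 : E) 1, ContDiffAt ℝ 1 g w) (u : E) (k : ℕ) :
    ∫ w, g w * fderiv ℝ (fun w : E => radialCutoff k (‖w‖ ^ 2)) w u ∂μ =
      -∫ w, fderiv ℝ g w u * radialCutoff k (‖w‖ ^ 2) ∂μ := by
  have hgc : ContinuousOn g (Metric.closedBall 0 1) := fun w hw =>
    (hg w hw).continuousAt.continuousWithinAt
  have hg'c : ContinuousOn (fun w => fderiv ℝ g w u) (Metric.closedBall 0 1) := fun w hw =>
    (((hg w hw).fderiv_right (m := 0) le_rfl).continuousAt.clm_apply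
      continuousAt_const).continuousWithinAt
  have hcutoff : ContDiff ℝ 1 fun w : E => radialCutoff k (‖w‖ ^ 2) :=
    (contDiff_radialCutoff k).comp (contDiff_norm_sq ℝ)
  have hsupp := support_radialCutoff_norm_sq_subset (E := E) k
  exact integral_mul_fderiv_eq_neg_fderiv_mul_of_integrable
    (integrable_mul_of_support_subset_closedBall hg'c hcutoff.continuous hsupp)
    (integrable_mul_fderiv_radialCutoff hgc u k)
    (integrable_mul_of_support_subset_closedBall hgc hcutoff.continuous hsupp)
    (fun w hw => (hg w (closure_minimal hsupp Metric.isClosed_closedBall hw)).differentiableAt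
      one_ne_zero)
    (fun w _ => hcutoff.differentiable one_ne_zero w)

theorem integral_sphere_mul_inner [Nontrivial E] (μ : Measure E) [μ.IsAddHaarMeasure] {g : E → ℝ}
    (hg : ∀ w ∈ Metric.closedBall (0 : E) 1, ContDiffAt ℝ 1 g w) (u : E) :
    ∫ z : Metric.sphere (0 : E) 1, g z * inner ℝ (z : E) u ∂μ.toSphere =
      ∫ w in Metric.ball (0 : E) 1, fderiv ℝ g w u ∂μ := by
  have hgc : ContinuousOn g (Metric.closedBall 0 1) := fun w hw =>
    (hg w hw).continuousAt.continuousWithinAt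
  have hg'c : ContinuousOn (fun w => fderiv ℝ g w u) (Metric.closedBall 0 1) := fun w hw =>
    (((hg w hw).fderiv_right (m := 0) le_rfl).continuousAt.clm_apply
      continuousAt_const).continuousWithinAt
  have hsphere := tendsto_integral_deriv_radialCutoff_mul
    ((continuous_pow (Module.finrank ℝ E - 1)).continuousOn.mul
      (continuousOn_integral_sphere (μ := μ) hgc u))
  have hball := tendsto_integral_mul_radialCutoff (μ := μ) hg'c
  have hparts (k : ℕ) := (neg_inj.1 ((integral_mul_fderiv_radialCutoff μ hgc u k).symm.trans
    (integral_mul_fderiv_radialCutoff_eq_neg hg u k)))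
  simpa using tendsto_nhds_unique (hsphere.congr hparts) hball

end Divergence

/-! ### Rewards and their means over an ellipsoid -/

section StrongConcavity

variable {E : Type*} [NormedAddCommGroup E] {S : Set E} {f : E → ℝ} {m : ℝ} {x y : E}

lemma le_add_inner_sub_of_strongConcaveOn [InnerProductSpace ℝ E] [CompleteSpace E] {g : E}
    (hf : StrongConcaveOn S m f) (hx : x ∈ S) (hy : y ∈ S) (hg : HasGradientAt f g x) :
    f y ≤ f x + inner ℝ g (y - x) - m / 2 * ‖y - x‖ ^ 2 := by
  have hconvex := (strongConcaveOn_iff_convex.1 hf).neg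
  have hderiv := (hg.hasFDerivAt.add ((hasStrictFDerivAt_norm_sq x).hasFDerivAt.const_mul
    (m / 2))).neg
  have htangent := add_fderiv_le_of_convexOn hconvex hx hy hderiv
  simp only [Pi.neg_apply, neg_apply, add_apply, smul_apply, InnerProductSpace.toDual_apply_apply,
    innerSL_apply_apply, smul_eq_mul, nsmul_eq_mul, Nat.cast_ofNat] at htangent
  rw [norm_sub_sq_real, real_inner_comm x y]
  rw [inner_sub_right x, real_inner_self_eq_norm_sq] at htangent
  linarith

variable [NormedSpace ℝ E] {L : ℝ}

lemma mul_norm_sub_sq_le_of_strongConcaveOn (hf : StrongConcaveOn S m f)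
    (hL : ∀ w ∈ S, |f w| ≤ L) (hx : x ∈ S) (hy : y ∈ S) : m * ‖x - y‖ ^ 2 ≤ 16 * L := by
  have hhalf : (0 : ℝ) ≤ 1 / 2 := by norm_num
  have hsum : (1 / 2 : ℝ) + 1 / 2 = 1 := by norm_num
  have hmid := hf.2 hx hy hhalf hhalf hsum
  simp only [smul_eq_mul] at hmid
  linarith [(abs_le.1 (hL _ (hf.1 hx hy hhalf hhalf hsum))).2, (abs_le.1 (hL x hx)).1,
    (abs_le.1 (hL y hy)).1]

lemma le_add_mul_of_concaveOn_of_abs_le (hf : ConcaveOn ℝ S f) (hL : ∀ w ∈ S, |f w| ≤ L)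
    (hx : x ∈ S) (hy : y ∈ S) {s : ℝ} (hs : s ∈ Icc 0 1) :
    f y ≤ f (x + s • (y - x)) + (1 - s) * (2 * L) := by
  have hcombo := hf.2 hy hx hs.1 (sub_nonneg.2 hs.2) (by ring)
  rw [show s • y + (1 - s) • x = x + s • (y - x) by module] at hcombo
  simp only [smul_eq_mul] at hcombo
  have hrange : f y - f x ≤ 2 * L := by
    linarith [(abs_le.1 (hL y hy)).2, (abs_le.1 (hL x hx)).1]
  linarith [mul_le_mul_of_nonneg_left hrange (sub_nonneg.2 hs.2)]

lemma sum_le_sum_add_of_concaveOn_of_abs_le {f : ℕ → E → ℝ} {T : ℕ} (hT : 1 ≤ T)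
    (hf : ∀ t ∈ Finset.Icc 1 T, ConcaveOn ℝ S (f t))
    (hL : ∀ t ∈ Finset.Icc 1 T, ∀ w ∈ S, |f t w| ≤ L) (hx : x ∈ S) (hy : y ∈ S) :
    ∑ t ∈ Finset.Icc 1 T, f t y ≤
      ∑ t ∈ Finset.Icc 1 T, f t (x + (1 - 1 / (T : ℝ)) • (y - x)) + 2 * L := by
  have hT' : (1 : ℝ) ≤ T := by exact_mod_cast hT
  have hs : 1 - 1 / (T : ℝ) ∈ Icc (0 : ℝ) 1 :=
    ⟨sub_nonneg.2 ((div_le_one (by linarith)).2 hT'), sub_le_self _ (by positivity)⟩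
  refine (Finset.sum_le_sum fun t ht =>
    le_add_mul_of_concaveOn_of_abs_le (hf t ht) (hL t ht) hx hy hs).trans_eq ?_
  rw [Finset.sum_add_distrib, Finset.sum_const, Nat.card_Icc, Nat.add_sub_cancel, nsmul_eq_mul,
    sub_sub_cancel]
  field_simp

end StrongConcavity

namespace IsReward

variable {n : ℕ} {X : Set (Eucl n)} {β L : ℝ} {ℓ : ℝ≥0} {f : Eucl n → ℝ} {x y p : Eucl n}
  (hf : IsReward X β L ℓ f)
include hf

lemma continuousOn : ContinuousOn f X := by
  obtain ⟨G, hG⟩ := hf.lipschitz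
  exact hG.continuousOn

lemma concaveOn (hβ : 0 ≤ β) : ConcaveOn ℝ X f :=
  hf.strongConcaveOn.concaveOn fun r => by dsimp only [Pi.zero_apply]; positivity

lemma hasGradientAt (hx : x ∈ interior X) : HasGradientAt f (∇ f x) x :=
  hf.differentiableOn.hasGradientAt (isOpen_interior.mem_nhds hx)

lemma contDiffAt (hx : x ∈ interior X) : ContDiffAt ℝ 1 f x := by
  have hfderiv := (InnerProductSpace.toDual ℝ (Eucl n)).continuous.comp_continuousOn
    hf.smooth.continuousOn
  rw [toDual_comp_gradient] at hfderiv
  exact ((contDiffOn_succ_iff_fderiv_of_isOpen (n := 0) isOpen_interior).2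
    ⟨hf.differentiableOn, by simp, contDiffOn_zero.2 hfderiv⟩).contDiffAt
      (isOpen_interior.mem_nhds hx)

lemma le_tangent (hy : y ∈ interior X) (hp : p ∈ X) :
    f p ≤ f y + inner ℝ (∇ f y) (p - y) - β / 2 * ‖p - y‖ ^ 2 :=
  le_add_inner_sub_of_strongConcaveOn hf.strongConcaveOn (interior_subset hy) hp
    (hf.hasGradientAt hy)

lemma isCompact (hβ : 0 < β) (hX : IsClosed X) : IsCompact X := by
  refine Metric.isCompact_of_isClosed_isBounded hX (Metric.isBounded_iff.2
    ⟨√(16 * L / β), fun x hx y hy => ?_⟩)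
  rw [dist_eq_norm]
  exact Real.le_sqrt_of_sq_le ((le_div_iff₀' hβ).2
    (mul_norm_sub_sq_le_of_strongConcaveOn hf.strongConcaveOn hf.bounded hx hy))

lemma neg_mul_norm_sub_sq_le_inner_gradient_sub (hx : x ∈ interior X) (hy : y ∈ interior X) :
    -(ℓ * ‖y - x‖ ^ 2) ≤ inner ℝ (∇ f y - ∇ f x) (y - x) := by
  refine neg_le_of_abs_le ((abs_real_inner_le_norm _ _).trans ?_)
  calc ‖∇ f y - ∇ f x‖ * ‖y - x‖ ≤ ℓ * ‖y - x‖ * ‖y - x‖ := by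
        gcongr
        exact hf.smooth.norm_sub_le hy hx
    _ = ℓ * ‖y - x‖ ^ 2 := by ring

lemma le_inner_gradient (hβ : 0 ≤ β) (hx : x ∈ interior X) (hy : y ∈ interior X) (hp : p ∈ X) :
    f p - f x + β / 2 * ‖p - x‖ ^ 2 - ℓ * ‖y - x‖ ^ 2 - β * inner ℝ (p - x) (y - x) ≤
      inner ℝ (∇ f y) (p - x) := by
  have hpy := hf.le_tangent hy hp
  have hyx := hf.le_tangent hx (interior_subset hy)
  have hsmooth := hf.neg_mul_norm_sub_sq_le_inner_gradient_sub hx hy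
  rw [← sub_sub_sub_cancel_right p y x, norm_sub_sq_real, inner_sub_right] at hpy
  rw [inner_sub_left] at hsmooth
  linarith [mul_nonneg hβ (sq_nonneg ‖y - x‖)]

lemma tangent_sub_le (hβ : 0 ≤ β) (hx : x ∈ interior X) (hy : y ∈ interior X) :
    f x + inner ℝ (∇ f x) (y - x) - ℓ * ‖y - x‖ ^ 2 ≤ f y := by
  have hxy := hf.le_tangent hy (interior_subset hx)
  have hsmooth := hf.neg_mul_norm_sub_sq_le_inner_gradient_sub hx hy
  rw [← neg_sub y x, inner_neg_right] at hxy
  rw [inner_sub_left] at hsmooth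
  linarith [mul_nonneg hβ (sq_nonneg ‖-(y - x)‖)]

end IsReward

section UniformMeans

lemma le_integral_of_add_le {α : Type*} [MeasurableSpace α] {μ : Measure α}
    [IsProbabilityMeasure μ] {F G : α → ℝ} {c : ℝ} (hF : Integrable F μ) (hG : Integrable G μ)
    (hG₀ : ∫ a, G a ∂μ = 0) (hle : ∀ᵐ a ∂μ, c + G a ≤ F a) : c ≤ ∫ a, F a ∂μ := by
  have h := integral_mono_ae ((integrable_const c).add hG) hF hle
  simpa [integral_add (integrable_const c) hG, hG₀] using h

lemma integrable_of_continuous {Z : Type*} [TopologicalSpace Z] [CompactSpace Z]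
    [MeasurableSpace Z] [BorelSpace Z] {F : Z → ℝ} (hF : Continuous F) (μ : Measure Z)
    [IsFiniteMeasure μ] : Integrable F μ :=
  hF.integrable_of_hasCompactSupport (HasCompactSupport.of_compactSpace F)

lemma setIntegral_ball_continuousLinearMap {E : Type*} [NormedAddCommGroup E] [NormedSpace ℝ E]
    [MeasurableSpace E] [BorelSpace E] (μ : Measure E) [μ.IsNegInvariant] (Λ : E →L[ℝ] ℝ) (r : ℝ) :
    ∫ w in Metric.ball (0 : E) r, Λ w ∂μ = 0 := by
  have h := (Measure.measurePreserving_neg μ).setIntegral_preimage_emb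
    (MeasurableEquiv.neg E).measurableEmbedding Λ (Metric.ball 0 r)
  simp only [map_neg, integral_neg, neg_preimage, neg_ball, neg_zero] at h
  linarith

/-- The uniform probability measure on the open unit ball of `ℝⁿ`: the smoothing distribution
whose mean gradient the single-shot estimator recovers. -/
noncomputable def ballUniform (n : ℕ) : Measure (Eucl n) :=
  ProbabilityTheory.cond volume (Metric.ball 0 1)

variable {n : ℕ}

instance isProbabilityMeasure_ballUniform : IsProbabilityMeasure (ballUniform n) :=
  cond_isProbabilityMeasure_of_finite (Metric.measure_ball_pos _ _ one_pos).ne'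
    measure_ball_lt_top.ne

lemma ae_ballUniform_norm_le_one : ∀ᵐ w ∂ballUniform n, ‖w‖ ≤ 1 := by
  filter_upwards [ae_cond_mem (μ := volume) (Metric.isOpen_ball (x := (0 : Eucl n))
    (ε := 1)).measurableSet] with w hw
  exact (mem_ball_zero_iff.1 hw).le

lemma integral_ballUniform (F : Eucl n → ℝ) : ∫ w, F w ∂ballUniform n =
    (volume.real (Metric.ball (0 : Eucl n) 1))⁻¹ * ∫ w in Metric.ball (0 : Eucl n) 1, F w := by
  rw [ballUniform, ProbabilityTheory.cond, integral_smul_measure, ENNReal.toReal_inv, smul_eq_mul,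
    measureReal_def]

lemma integrable_ballUniform {F : Eucl n → ℝ} (hF : ContinuousOn F (Metric.closedBall 0 1)) :
    Integrable F (ballUniform n) :=
  ((hF.integrableOn_compact (isCompact_closedBall _ _)).mono_set
    Metric.ball_subset_closedBall).smul_measure
      (ENNReal.inv_ne_top.2 (Metric.measure_ball_pos _ _ one_pos).ne')

variable [NeZero n]

instance isProbabilityMeasure_sphereUniform : IsProbabilityMeasure (sphereUniform n) :=
  have : NeZero (volume : Measure (Eucl n)).toSphere := ⟨Measure.toSphere_ne_zero _⟩
  isProbabilityMeasureSMul

lemma mul_integral_sphereUniform_mul_inner {g : Eucl n → ℝ}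
    (hg : ∀ w ∈ Metric.closedBall (0 : Eucl n) 1, ContDiffAt ℝ 1 g w) (u : Eucl n) :
    n * ∫ z, g z * inner ℝ (z : Eucl n) u ∂(sphereUniform n) =
      ∫ w, fderiv ℝ g w u ∂(ballUniform n) := by
  have hn : (n : ℝ) ≠ 0 := NeZero.ne _
  rw [integral_ballUniform, ← integral_sphere_mul_inner volume hg u, sphereUniform,
    integral_smul_measure, ENNReal.toReal_inv, ← measureReal_def,
    Measure.toSphere_real_apply_univ, finrank_euclideanSpace_fin, smul_eq_mul]
  field_simp

lemma integral_inner_sphereUniform (u : Eucl n) :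
    ∫ z, inner ℝ (z : Eucl n) u ∂(sphereUniform n) = 0 := by
  have h := mul_integral_sphereUniform_mul_inner (g := fun _ : Eucl n => 1)
    (fun _ _ => contDiffAt_const) u
  simpa [NeZero.ne n] using h

end UniformMeans

section Round

variable {n : ℕ} {ν : ℝ} {X : Set (Eucl n)} {R : Eucl n → ℝ} {β η L : ℝ} {ℓ : ℝ≥0}
  {f : Eucl n → ℝ} {t : ℕ} {x p : Eucl n}

lemma contDiff_play : ContDiff ℝ 1 fun w => play R β t x w η := by
  unfold play
  fun_prop

lemma hasFDerivAt_play (w : Eucl n) : HasFDerivAt (fun w => play R β t x w η)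
    (Matrix.toEuclideanCLM (𝕜 := ℝ) (scaling R β t x η)) w :=
  (ContinuousLinearMap.hasFDerivAt _).const_add x

lemma IsSelfConcordantBarrier.mul_norm_play_sub_sq_le (hR : IsSelfConcordantBarrier ν X R)
    (hc : 0 < η * β * (t + 1)) (hx : x ∈ interior X) {z : Eucl n} (hz : ‖z‖ ≤ 1) :
    ℓ * ‖play R β t x z η - x‖ ^ 2 ≤ ℓ / (η * β * (t + 1)) := by
  rw [play, add_sub_cancel_left, ← mul_one_div]
  gcongr
  exact hR.norm_scaling_sq_le hc hx hz

lemma isHermitian_scaling : (scaling R β t x η).IsHermitian :=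
  isHermitian_cfc _ _

lemma inner_gradEst (z v : Eucl n) :
    inner ℝ (gradEst R β t f x z η) v = n * (f (play R β t x z η) *
      inner ℝ z (Matrix.toEuclideanCLM (𝕜 := ℝ) (scaling R β t x η)⁻¹ v)) := by
  rw [gradEst, real_inner_smul_left, inner_toEuclideanCLM_comm isHermitian_scaling.inv,
    mul_assoc]

variable [NeZero n] (hR : IsSelfConcordantBarrier ν X R) (hf : IsReward X β L ℓ f)
  (hc : 0 < η * β * (t + 1)) (hx : x ∈ interior X)
include hR hf hc hx

-- The divergence theorem on the unit ball, applied to `f` along the points `play`.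
lemma integral_inner_gradEst (v : Eucl n) :
    ∫ z, inner ℝ (gradEst R β t f x z η) v ∂(sphereUniform n) =
      ∫ w, inner ℝ (∇ f (play R β t x w η)) v ∂(ballUniform n) := by
  have hmem : ∀ {w : Eucl n}, ‖w‖ ≤ 1 → play R β t x w η ∈ interior X :=
    fun hw => hR.play_mem_interior hc hx hw
  simp only [inner_gradEst]
  rw [integral_const_mul, mul_integral_sphereUniform_mul_inner
    (g := fun w => f (play R β t x w η)) fun w hw =>
      (hf.contDiffAt (hmem (by simpa using hw))).comp w contDiff_play.contDiffAt]
  refine integral_congr_ae ?_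
  filter_upwards [ae_ballUniform_norm_le_one] with w hw
  have hderiv := (hf.hasGradientAt (hmem hw)).hasFDerivAt.comp w (hasFDerivAt_play w)
  rw [Function.comp_def] at hderiv
  rw [hderiv.fderiv, ContinuousLinearMap.comp_apply, InnerProductSpace.toDual_apply_apply,
    hR.scaling_apply_scaling_inv hc hx]

lemma le_integral_inner_gradEst (hβ : 0 ≤ β) (hp : p ∈ X) :
    f p - f x + β / 2 * ‖p - x‖ ^ 2 - ℓ / (η * β * (t + 1)) ≤
      ∫ z, inner ℝ (gradEst R β t f x z η) (p - x) ∂(sphereUniform n) := by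
  have hmem : ∀ {w : Eucl n}, ‖w‖ ≤ 1 → play R β t x w η ∈ interior X :=
    fun hw => hR.play_mem_interior hc hx hw
  let Λ : Eucl n →L[ℝ] ℝ := -β • (innerSL ℝ (p - x)).comp
    (Matrix.toEuclideanCLM (𝕜 := ℝ) (scaling R β t x η))
  rw [integral_inner_gradEst hR hf hc hx]
  refine le_integral_of_add_le (G := Λ) (integrable_ballUniform ?_)
    (integrable_ballUniform Λ.continuous.continuousOn) ?_ ?_
  · exact (hf.smooth.continuousOn.comp contDiff_play.continuous.continuousOn
      fun w hw => hmem (by simpa using hw)).inner continuousOn_const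
  · rw [integral_ballUniform, setIntegral_ball_continuousLinearMap, mul_zero]
  · filter_upwards [ae_ballUniform_norm_le_one] with w hw
    have hΛ : Λ w = -β * inner ℝ (p - x) (play R β t x w η - x) := by
      rw [play, add_sub_cancel_left]
      rfl
    linarith [hf.le_inner_gradient hβ hx (hmem hw) hp,
      hR.mul_norm_play_sub_sq_le (ℓ := ℓ) hc hx hw]

lemma le_integral_play (hβ : 0 ≤ β) : f x - ℓ / (η * β * (t + 1)) ≤
    ∫ z : Metric.sphere (0 : Eucl n) 1, f (play R β t x z η) ∂(sphereUniform n) := by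
  have hmem : ∀ z : Metric.sphere (0 : Eucl n) 1, play R β t x z η ∈ interior X :=
    fun z => hR.play_mem_interior hc hx (by simp)
  refine le_integral_of_add_le (integrable_of_continuous ?_ _)
    (integrable_of_continuous (by fun_prop) _) (integral_inner_sphereUniform
      (Matrix.toEuclideanCLM (𝕜 := ℝ) (scaling R β t x η) (∇ f x))) (ae_of_all _ fun z => ?_)
  · exact hf.continuousOn.comp_continuous
      (contDiff_play.continuous.comp continuous_subtype_val) fun z => interior_subset (hmem z)
  · have hlinear : inner ℝ (z : Eucl n)
        (Matrix.toEuclideanCLM (𝕜 := ℝ) (scaling R β t x η) (∇ f x)) =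
          inner ℝ (∇ f x) (play R β t x z η - x) := by
      rw [play, add_sub_cancel_left, real_inner_comm, inner_toEuclideanCLM_comm
        isHermitian_scaling]
    linarith [hf.tangent_sub_le hβ hx (hmem z),
      hR.mul_norm_play_sub_sq_le (ℓ := ℓ) (z := z) hc hx (by simp)]

end Round

/-! ### Mirror descent along a sequence of directions -/

section MirrorStep

lemma mul_sub_sub_log_le {a b : ℝ} (ha : 0 ≤ a) (hb : b ≤ 1 / 2) :
    b * a - (a - Real.log (1 + a)) ≤ 2 * b ^ 2 := by
  have hb' : 0 < 1 - b := by linarith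
  have hlog := Real.log_le_sub_one_of_pos (mul_pos (by linarith : 0 < 1 + a) hb')
  rw [Real.log_mul (by linarith) hb'.ne'] at hlog
  have hinv : (1 - b)⁻¹ ≤ 1 + b + 2 * b ^ 2 := by
    rw [inv_le_iff_one_le_mul₀ hb']
    nlinarith [mul_nonneg (sq_nonneg b) (by linarith : 0 ≤ 1 - 2 * b)]
  linarith [Real.one_sub_inv_le_log_of_pos hb']

variable {n : ℕ} {ν : ℝ} {X : Set (Eucl n)} {R : Eucl n → ℝ}

lemma inner_gradient_sub_eq_bregman (R : Eucl n → ℝ) (p x x' : Eucl n) :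
    inner ℝ (∇ R x' - ∇ R x) (p - x') = bregman R p x - bregman R p x' - bregman R x' x := by
  simp only [bregman, inner_sub_left, inner_sub_right]
  ring

lemma inner_gradient_mixedBregman (R : Eucl n → ℝ) (c : ℝ) (p x x' : Eucl n) :
    inner ℝ (c • (x' - x) + (∇ R x' - ∇ R x)) (p - x') =
      mixedBregman R c p x - mixedBregman R c p x' - mixedBregman R c x' x := by
  have hcosine : ‖p - x‖ ^ 2 = ‖p - x'‖ ^ 2 + 2 * inner ℝ (x' - x) (p - x') + ‖x' - x‖ ^ 2 := by
    rw [← sub_add_sub_cancel p x' x, norm_add_sq_real, real_inner_comm]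
  rw [inner_add_left, real_inner_smul_left, inner_gradient_sub_eq_bregman]
  unfold mixedBregman
  linear_combination (-c / 2) * hcosine

variable {β L η : ℝ} {ℓ : ℝ≥0} {t : ℕ} {x p : Eucl n}

namespace IsSelfConcordantBarrier

lemma mul_inner_sub_le_of_prox (hR : IsSelfConcordantBarrier ν X R) (hX : IsCompact X)
    (hc : 0 < η * β * (t + 1)) (hη : 0 ≤ η) {G : ℝ} {v : Eucl n}
    (hv : ∀ d, inner ℝ v d ≤ G * localNorm R (η * β * (t + 1)) x d) (hG : η * G ≤ 1 / 2)
    (hx : x ∈ interior X) (p : Eucl n) :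
    η * inner ℝ v (p - x) ≤ mixedBregman R (η * β * (t + 1)) p x -
      mixedBregman R (η * β * (t + 1)) p (prox X R β t x v η) + 2 * (η * G) ^ 2 := by
  have hmem := (hR.prox_spec hX ⟨x, hx⟩ β t x v η).1
  have hstat := hR.smul_eq_of_prox hX ⟨x, hx⟩ β t x v η
  set x' := prox X R β t x v η
  have hsplit : η * inner ℝ v (p - x) = inner ℝ (η • v) (p - x') + η * inner ℝ v (x' - x) := by
    rw [real_inner_smul_left, ← mul_add, ← inner_add_right, sub_add_sub_cancel]
  rw [hstat, inner_gradient_mixedBregman] at hsplit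
  have hlog := hR.sub_log_le_mixedBregman hc hx hmem
  have hstable := mul_sub_sub_log_le (a := localNorm R (η * β * (t + 1)) x (x' - x))
    (Real.sqrt_nonneg _) hG
  linarith [mul_le_mul_of_nonneg_left (hv (x' - x)) hη]

lemma inner_gradEst_le (hR : IsSelfConcordantBarrier ν X R) (hc : 0 < η * β * (t + 1))
    {f : Eucl n → ℝ} (hf : ∀ w ∈ interior X, |f w| ≤ L) (hx : x ∈ interior X) {z : Eucl n}
    (hz : ‖z‖ ≤ 1) (d : Eucl n) :
    inner ℝ (gradEst R β t f x z η) d ≤ n * L * localNorm R (η * β * (t + 1)) x d := by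
  have hfL := hf _ (hR.play_mem_interior hc hx hz)
  rw [inner_gradEst, ← hR.norm_scaling_inv hc hx, mul_assoc]
  set w := Matrix.toEuclideanCLM (𝕜 := ℝ) (scaling R β t x η)⁻¹ d
  refine mul_le_mul_of_nonneg_left ?_ n.cast_nonneg
  calc f (play R β t x z η) * inner ℝ z w
      ≤ |f (play R β t x z η)| * |inner ℝ z w| := (le_abs_self _).trans_eq (abs_mul _ _)
    _ ≤ L * ‖w‖ := mul_le_mul hfL ((abs_real_inner_le_norm _ _).trans
        (mul_le_of_le_one_left (norm_nonneg _) hz)) (abs_nonneg _) ((abs_nonneg _).trans hfL)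

end IsSelfConcordantBarrier

end MirrorStep

section Pivot

variable {n : ℕ} {ν : ℝ} {X : Set (Eucl n)} {R : Eucl n → ℝ} {β L : ℝ} {ℓ : ℝ≥0} {T : ℕ}
  {η : ℕ → ℝ} {f : ℕ → Eucl n → ℝ} {t : ℕ}

lemma pivot_succ (z : ℕ → Eucl n) (ht : 1 ≤ t) :
    pivot X R β η f z (t + 1) = prox X R β t (pivot X R β η f z t)
      (gradEst R β t (f t) (pivot X R β η f z t) (z t) (η t)) (η t) := by
  obtain ⟨s, rfl⟩ := Nat.exists_eq_add_of_le' ht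
  rfl

lemma pivot_congr {z z' : ℕ → Eucl n} (h : ∀ s < t, z s = z' s) :
    pivot X R β η f z t = pivot X R β η f z' t := by
  induction t with
  | zero => rfl
  | succ t ih =>
    rcases Nat.eq_zero_or_pos t with rfl | ht
    · rfl
    · rw [pivot_succ z ht, pivot_succ z' ht, ih fun s hs => h s (hs.trans t.lt_succ_self),
        h t t.lt_succ_self]

variable (hR : IsSelfConcordantBarrier ν X R) (hX : IsCompact X) (hne : (interior X).Nonempty)
include hR hX hne

lemma pivot_mem_interior (z : ℕ → Eucl n) (t : ℕ) : pivot X R β η f z t ∈ interior X := by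
  match t with
  | 0 => exact (hR.argmin_spec hX hne).1
  | 1 => exact (hR.argmin_spec hX hne).1
  | t + 2 => exact (hR.prox_spec hX hne ..).1

variable (hc : ∀ t : ℕ, 0 < η t * β * (t + 1))
include hc

lemma action_mem_interior {z : ℕ → Eucl n} (hz : ‖z t‖ ≤ 1) :
    action X R β η f z t ∈ interior X :=
  hR.play_mem_interior (hc t) (pivot_mem_interior hR hX hne z t) hz

variable (hf : ∀ t ∈ Finset.Icc 1 T, IsReward X β L ℓ (f t))
include hf

lemma continuous_pivot (ht : t ≤ T) :
    Continuous fun y : ℕ → Metric.sphere (0 : Eucl n) 1 => pivot X R β η f (fun s => y s) t := by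
  induction t with
  | zero => exact continuous_const
  | succ t ih =>
    rcases Nat.eq_zero_or_pos t with rfl | ht'
    · exact continuous_const
    · simp only [pivot_succ _ ht']
      have hpivot := ih (by omega)
      have hmem := fun y : ℕ → Metric.sphere (0 : Eucl n) 1 =>
        pivot_mem_interior (β := β) (η := η) (f := f) hR hX hne (fun s => y s) t
      exact hR.continuous_prox hX hne (hc t) hpivot hmem
        (hR.continuous_gradEst (hc t) hpivot hmem (by fun_prop) (fun y => by simp)
          ((hf t (Finset.mem_Icc.2 ⟨ht', by omega⟩)).continuousOn.mono interior_subset))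

variable (ht : t ∈ Finset.Icc 1 T)
include ht

lemma continuous_reward_pivot :
    Continuous fun y : ℕ → Metric.sphere (0 : Eucl n) 1 =>
      f t (pivot X R β η f (fun s => y s) t) :=
  (hf t ht).continuousOn.comp_continuous (continuous_pivot hR hX hne hc hf (Finset.mem_Icc.1 ht).2)
    fun _ => interior_subset (pivot_mem_interior hR hX hne _ t)

lemma continuous_reward_action :
    Continuous fun y : ℕ → Metric.sphere (0 : Eucl n) 1 =>
      f t (action X R β η f (fun s => y s) t) :=
  (hf t ht).continuousOn.comp_continuous
    (hR.continuous_play (hc t) (continuous_pivot hR hX hne hc hf (Finset.mem_Icc.1 ht).2)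
      (fun _ => pivot_mem_interior hR hX hne _ t) (by fun_prop))
    fun _ => interior_subset (action_mem_interior hR hX hne hc (by simp))

end Pivot

section RegretModel

variable {n : ℕ} {ν : ℝ} {X : Set (Eucl n)} {R : Eucl n → ℝ} {β L : ℝ} {ℓ : ℝ≥0} {T : ℕ}
  {f : ℕ → Eucl n → ℝ} {t : ℕ} {p : Eucl n}

/-- The quadratic model `⟨v̂ᵗ, p - xᵗ⟩ - β / 2 ‖p - xᵗ‖²` of the regret of round `t` against `p`
along a sequence of directions, with the estimator `v̂ᵗ` in place of the gradient: in expectation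
it dominates the regret of `xᵗ` up to the smoothing error, and mirror descent bounds its sum along
every sequence of directions. -/
noncomputable def regretModel (X : Set (Eucl n)) (R : Eucl n → ℝ) (β : ℝ) (η : ℕ → ℝ)
    (f : ℕ → Eucl n → ℝ) (p : Eucl n) (z : ℕ → Eucl n) (t : ℕ) : ℝ :=
  inner ℝ (gradEst R β t (f t) (pivot X R β η f z t) (z t) (η t)) (p - pivot X R β η f z t) -
    β / 2 * ‖p - pivot X R β η f z t‖ ^ 2

lemma continuous_regretModel {η : ℕ → ℝ} (hR : IsSelfConcordantBarrier ν X R) (hX : IsCompact X)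
    (hne : (interior X).Nonempty) (hc : ∀ t : ℕ, 0 < η t * β * (t + 1))
    (hf : ∀ t ∈ Finset.Icc 1 T, IsReward X β L ℓ (f t)) (ht : t ∈ Finset.Icc 1 T) :
    Continuous fun y : ℕ → Metric.sphere (0 : Eucl n) 1 =>
      regretModel X R β η f p (fun s => y s) t := by
  have hpivot := continuous_pivot hR hX hne hc hf (Finset.mem_Icc.1 ht).2
  have hgradEst := hR.continuous_gradEst (hc t) hpivot
    (fun _ => pivot_mem_interior hR hX hne _ t)
    (z := fun y : ℕ → Metric.sphere (0 : Eucl n) 1 => (y t : Eucl n)) (by fun_prop)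
    (fun _ => by simp) ((hf t ht).continuousOn.mono interior_subset)
  unfold regretModel
  fun_prop

variable {η : ℝ} (hR : IsSelfConcordantBarrier ν X R) (hX : IsCompact X)
  (hne : (interior X).Nonempty) (hη : 0 < η) (hβ : 0 < β) (hηL : η * (n * L) ≤ 1 / 2)
  {z : ℕ → Eucl n}
include hR hX hne hη hβ hηL

lemma mul_regretModel_le (hf : IsReward X β L ℓ (f t)) (ht : 1 ≤ t) (hz : ‖z t‖ ≤ 1) :
    η * regretModel X R β (fun _ => η) f p z t ≤
      mixedBregman R (η * β * t) p (pivot X R β (fun _ => η) f z t) -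
      mixedBregman R (η * β * (t + 1)) p (pivot X R β (fun _ => η) f z (t + 1)) +
      2 * (η * (n * L)) ^ 2 := by
  have hx := pivot_mem_interior (β := β) (η := fun _ => η) (f := f) hR hX hne z t
  have hc : 0 < η * β * (t + 1) := by positivity
  have hstep := hR.mul_inner_sub_le_of_prox hX hc hη.le (hR.inner_gradEst_le hc
    (fun w hw => hf.bounded w (interior_subset hw)) hx hz) hηL hx p
  rw [pivot_succ z ht]
  unfold regretModel mixedBregman at *
  linarith

lemma mul_sum_regretModel_le (hf : ∀ t ∈ Finset.Icc 1 T, IsReward X β L ℓ (f t))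
    (hz : ∀ t, ‖z t‖ ≤ 1) (hp : p ∈ interior X) :
    η * ∑ t ∈ Finset.Icc 1 T, regretModel X R β (fun _ => η) f p z t ≤
      mixedBregman R (η * β) p (argmin (interior X) R) + T * (2 * (η * (n * L)) ^ 2) := by
  set Φ : ℕ → ℝ := fun t => mixedBregman R (η * β * t) p (pivot X R β (fun _ => η) f z t) with hΦ
  have hround : ∀ t ∈ Finset.Icc 1 T, η * regretModel X R β (fun _ => η) f p z t ≤
      -(Φ (t + 1) - Φ t) + 2 * (η * (n * L)) ^ 2 := fun t ht => by
    have hstep := mul_regretModel_le (p := p) hR hX hne hη hβ hηL (hf t ht)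
      (Finset.mem_Icc.1 ht).1 (hz t)
    simp only [hΦ]
    push_cast
    linarith
  have hΦ₁ : Φ 1 = mixedBregman R (η * β) p (argmin (interior X) R) := by simp [hΦ, pivot]
  have hΦT : 0 ≤ Φ (T + 1) := by
    have hx := pivot_mem_interior (β := β) (η := fun _ => η) (f := f) hR hX hne z (T + 1)
    exact add_nonneg (bregman_nonneg hR.convexOn hx hp (hR.differentiableAt hx)) (by positivity)
  calc η * ∑ t ∈ Finset.Icc 1 T, regretModel X R β (fun _ => η) f p z t
      ≤ ∑ t ∈ Finset.Icc 1 T, (-(Φ (t + 1) - Φ t) + 2 * (η * (n * L)) ^ 2) := by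
        rw [Finset.mul_sum]
        exact Finset.sum_le_sum hround
    _ = Φ 1 - Φ (T + 1) + T * (2 * (η * (n * L)) ^ 2) := by
        rw [Finset.sum_add_distrib, Finset.sum_neg_distrib, ← Finset.Ico_add_one_right_eq_Icc,
          Finset.sum_Ico_sub Φ (by omega)]
        simp
    _ ≤ mixedBregman R (η * β) p (argmin (interior X) R) + T * (2 * (η * (n * L)) ^ 2) := by
        linarith

lemma sum_regretModel_le (hf : ∀ t ∈ Finset.Icc 1 T, IsReward X β L ℓ (f t)) (hT : 1 ≤ T)
    (hz : ∀ t, ‖z t‖ ≤ 1) (hp : p ∈ interior X) :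
    ∑ t ∈ Finset.Icc 1 T, regretModel X R β (fun _ => η) f p z t ≤
      8 * L + (R p - R (argmin (interior X) R)) / η + 2 * T * η * (n * L) ^ 2 := by
  have hsum := mul_sum_regretModel_le hR hX hne hη hβ hηL hf hz hp
  have hf₁ := hf 1 (Finset.mem_Icc.2 ⟨le_rfl, hT⟩)
  have hdiam := mul_norm_sub_sq_le_of_strongConcaveOn hf₁.strongConcaveOn hf₁.bounded
    (interior_subset hp) (interior_subset (hR.argmin_spec hX hne).1)
  rw [mixedBregman, bregman, hR.gradient_argmin hX hne, inner_zero_left, sub_zero] at hsum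
  refine le_of_mul_le_mul_left (hsum.trans ?_) hη
  calc R p - R (argmin (interior X) R) + η * β / 2 * ‖p - argmin (interior X) R‖ ^ 2 +
        T * (2 * (η * (n * L)) ^ 2)
      = R p - R (argmin (interior X) R) + η / 2 * (β * ‖p - argmin (interior X) R‖ ^ 2) +
        T * (2 * (η * (n * L)) ^ 2) := by ring
    _ ≤ R p - R (argmin (interior X) R) + η / 2 * (16 * L) + T * (2 * (η * (n * L)) ^ 2) := by
        gcongr
    _ = η * (8 * L + (R p - R (argmin (interior X) R)) / η + 2 * T * η * (n * L) ^ 2) := by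
        field_simp
        ring

end RegretModel

section Resampling

variable {ι : Type*} [DecidableEq ι] {S : ι → Type*} [∀ i, MeasurableSpace (S i)]
  {μ : ∀ i, Measure (S i)} [∀ i, IsProbabilityMeasure (μ i)]

lemma map_update_infinitePi (i : ι) :
    ((Measure.infinitePi μ).prod (μ i)).map (fun q => Function.update q.1 i q.2) =
      Measure.infinitePi μ := by
  refine Measure.eq_infinitePi _ fun s B hB => ?_
  rw [Measure.map_apply measurable_update' (.pi s.countable_toSet fun j _ => hB j)]
  have hbox : (fun q : (∀ j, S j) × S i => Function.update q.1 i q.2) ⁻¹' (s : Set ι).pi B =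
      ((s.erase i : Finset ι) : Set ι).pi B ×ˢ {u | i ∈ s → u ∈ B i} := by
    ext ⟨y, u⟩
    simp only [mem_preimage, Set.mem_pi, Finset.mem_coe, mem_prod, Finset.mem_erase, mem_ofPred_eq]
    refine ⟨fun h => ⟨fun j hj => by simpa [hj.1] using h j hj.2, fun hi => by simpa using h i hi⟩,
      fun h j hj => ?_⟩
    rcases eq_or_ne j i with rfl | hji
    · simpa using h.2 hj
    · simpa [hji] using h.1 j ⟨hji, hj⟩
  rw [hbox, Measure.prod_prod, Measure.infinitePi_pi _ fun j _ => hB j]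
  by_cases hi : i ∈ s
  · simp [hi, Finset.prod_erase_mul]
  · simp [hi, Finset.erase_eq_of_notMem]

lemma integral_le_integral_of_forall_update {g F : (∀ i, S i) → ℝ} (i : ι)
    (hg : Integrable g (Measure.infinitePi μ)) (hF : Integrable F (Measure.infinitePi μ))
    (hle : ∀ y, g y ≤ ∫ u, F (Function.update y i u) ∂μ i) :
    ∫ y, g y ∂Measure.infinitePi μ ≤ ∫ y, F y ∂Measure.infinitePi μ := by
  have hmap := map_update_infinitePi (μ := μ) i
  have hFi := (hmap ▸ hF).comp_measurable measurable_update'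
  calc ∫ y, g y ∂Measure.infinitePi μ
      ≤ ∫ y, ∫ u, F (Function.update y i u) ∂μ i ∂Measure.infinitePi μ :=
        integral_mono hg hFi.integral_prod_left hle
    _ = ∫ q, F (Function.update q.1 i q.2) ∂(Measure.infinitePi μ).prod (μ i) :=
        (integral_prod _ hFi).symm
    _ = ∫ y, F y ∂Measure.infinitePi μ := by
        rw [← integral_map measurable_update'.aemeasurable (hmap.symm ▸ hF.1), hmap]

end Resampling

/-! ### Expected regret -/

section ExpectedRegret

/-- The law of an independent sequence of uniform directions. Expectations are computed under this
law, where all the random variables of the algorithm are continuous functions on a compact space,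
and transferred to the given probability space at the end. -/
noncomputable def directionLaw (n : ℕ) : Measure (ℕ → Metric.sphere (0 : Eucl n) 1) :=
  Measure.infinitePi fun _ => sphereUniform n

instance isProbabilityMeasure_directionLaw {n : ℕ} [NeZero n] :
    IsProbabilityMeasure (directionLaw n) := by
  unfold directionLaw
  infer_instance

lemma hasLaw_directionLaw {n : ℕ} {Ω : Type*} [MeasurableSpace Ω] {P : Measure Ω}
    {z : ℕ → Ω → Metric.sphere (0 : Eucl n) 1} (hz : ∀ t, Measurable (z t)) (hind : iIndepFun z P)
    (hlaw : ∀ t, P.map (z t) = sphereUniform n) :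
    HasLaw (fun ω s => z s ω) (directionLaw n) P where
  map_eq := by
    rw [hind.map_fun_eq_infinitePi_map hz, directionLaw]
    simp only [hlaw]

variable {n : ℕ} [NeZero n] {ν : ℝ} {X : Set (Eucl n)} {R : Eucl n → ℝ} {β L : ℝ} {ℓ : ℝ≥0} {T : ℕ}
  {f : ℕ → Eucl n → ℝ} {t : ℕ} {p : Eucl n}

section VariableStep

variable {η : ℕ → ℝ} (hR : IsSelfConcordantBarrier ν X R) (hX : IsCompact X)
  (hne : (interior X).Nonempty) (hβ : 0 ≤ β) (hc : ∀ t : ℕ, 0 < η t * β * (t + 1))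
  (hf : ∀ t ∈ Finset.Icc 1 T, IsReward X β L ℓ (f t)) (ht : t ∈ Finset.Icc 1 T)
include hR hX hne hβ hc hf ht

lemma sub_integral_reward_pivot_le (hp : p ∈ X) :
    f t p - ∫ y, f t (pivot X R β η f (fun s => y s) t) ∂directionLaw n ≤
      ∫ y, regretModel X R β η f p (fun s => y s) t ∂directionLaw n +
        ℓ / (η t * β * (t + 1)) := by
  have hreward := integrable_of_continuous (continuous_reward_pivot hR hX hne hc hf ht)
    (directionLaw n)
  have hle := integral_le_integral_of_forall_update (μ := fun _ => sphereUniform n)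
    (g := fun y => f t p - ℓ / (η t * β * (t + 1)) - f t (pivot X R β η f (fun s => y s) t)) t
    ((integrable_const _).sub hreward)
    (integrable_of_continuous (continuous_regretModel (p := p) hR hX hne hc hf ht) _) fun y => ?_
  · change ∫ y, _ ∂directionLaw n ≤ ∫ y, _ ∂directionLaw n at hle
    rw [integral_sub (integrable_const _) hreward, integral_const, probReal_univ, one_smul] at hle
    linarith
  · have hpivot : ∀ u, pivot X R β η f (fun s => Function.update y t u s) t =
        pivot X R β η f (fun s => y s) t :=
      fun u => pivot_congr fun s hs => by simp [hs.ne]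
    have hmem := pivot_mem_interior (β := β) (η := η) (f := f) hR hX hne (fun s => y s) t
    simp only [regretModel, hpivot, Function.update_self]
    rw [integral_sub (integrable_of_continuous ?_ _) (integrable_const _), integral_const,
      probReal_univ, one_smul]
    · linarith [le_integral_inner_gradEst hR (hf t ht) (hc t) hmem hβ hp]
    · exact (hR.continuous_gradEst (hc t) continuous_const (fun _ => hmem) continuous_subtype_val
        (fun _ => by simp) ((hf t ht).continuousOn.mono interior_subset)).inner continuous_const

lemma integral_reward_pivot_le :
    ∫ y, f t (pivot X R β η f (fun s => y s) t) ∂directionLaw n ≤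
      ∫ y, f t (action X R β η f (fun s => y s) t) ∂directionLaw n +
        ℓ / (η t * β * (t + 1)) := by
  have hreward := integrable_of_continuous (continuous_reward_pivot hR hX hne hc hf ht)
    (directionLaw n)
  have hle := integral_le_integral_of_forall_update (μ := fun _ => sphereUniform n)
    (g := fun y => f t (pivot X R β η f (fun s => y s) t) - ℓ / (η t * β * (t + 1))) t
    (hreward.sub (integrable_const _))
    (integrable_of_continuous (continuous_reward_action hR hX hne hc hf ht) _) fun y => ?_
  · change ∫ y, _ ∂directionLaw n ≤ ∫ y, _ ∂directionLaw n at hle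
    rw [integral_sub hreward (integrable_const _), integral_const, probReal_univ, one_smul] at hle
    linarith
  · have hpivot : ∀ u, pivot X R β η f (fun s => Function.update y t u s) t =
        pivot X R β η f (fun s => y s) t :=
      fun u => pivot_congr fun s hs => by simp [hs.ne]
    simp only [action, hpivot, Function.update_self]
    exact le_integral_play hR (hf t ht) (hc t) (pivot_mem_interior hR hX hne _ t) hβ

end VariableStep

lemma sum_div_le_log {c : ℝ} (hc : 0 ≤ c) (T : ℕ) :
    ∑ t ∈ Finset.Icc 1 T, c / ((t : ℝ) + 1) ≤ c * (1 + Real.log T) := by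
  have hharmonic := harmonic_le_one_add_log T
  rw [harmonic_eq_sum_Icc] at hharmonic
  push_cast at hharmonic
  refine le_trans ?_ (mul_le_mul_of_nonneg_left hharmonic hc)
  rw [Finset.mul_sum]
  refine Finset.sum_le_sum fun t ht => ?_
  have ht' : (0 : ℝ) < t := by exact_mod_cast (Finset.mem_Icc.1 ht).1
  rw [div_eq_mul_inv]
  gcongr
  linarith

variable {η : ℝ} (hR : IsSelfConcordantBarrier ν X R) (hX : IsCompact X)
  (hne : (interior X).Nonempty) (hβ : 0 < β) (hη : 0 < η) (hηL : η * (n * L) ≤ 1 / 2)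
  (hf : ∀ t ∈ Finset.Icc 1 T, IsReward X β L ℓ (f t)) (hT : 1 ≤ T)
include hR hX hne hβ hη hf

lemma sum_sub_integral_reward_action_le :
    ∑ t ∈ Finset.Icc 1 T,
        (f t p - ∫ y, f t (action X R β (fun _ => η) f (fun s => y s) t) ∂directionLaw n) ≤
      ∑ t ∈ Finset.Icc 1 T,
        (f t p - ∫ y, f t (pivot X R β (fun _ => η) f (fun s => y s) t) ∂directionLaw n) +
      ℓ / (η * β) * (1 + Real.log T) := by
  refine le_trans ?_ (add_le_add_right (sum_div_le_log (by positivity) T) _)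
  rw [← Finset.sum_add_distrib]
  refine Finset.sum_le_sum fun t ht => ?_
  have hround := integral_reward_pivot_le (η := fun _ => η) hR hX hne hβ.le
    (fun t => by positivity) hf ht
  rw [div_div]
  linarith

include hηL hT

lemma sum_sub_integral_reward_pivot_le_of_mem_interior (hp : p ∈ interior X) :
    ∑ t ∈ Finset.Icc 1 T,
        (f t p - ∫ y, f t (pivot X R β (fun _ => η) f (fun s => y s) t) ∂directionLaw n) ≤
      8 * L + (R p - R (argmin (interior X) R)) / η + 2 * T * η * (n * L) ^ 2 +
        ℓ / (η * β) * (1 + Real.log T) := by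
  have hc : ∀ t : ℕ, 0 < η * β * (t + 1) := fun t => by positivity
  have hintegrable : ∀ t ∈ Finset.Icc 1 T,
      Integrable (fun y => regretModel X R β (fun _ => η) f p (fun s => y s) t) (directionLaw n) :=
    fun t ht => integrable_of_continuous
      (continuous_regretModel (η := fun _ => η) hR hX hne hc hf ht) _
  have hmodel : ∫ y, ∑ t ∈ Finset.Icc 1 T, regretModel X R β (fun _ => η) f p (fun s => y s) t
      ∂directionLaw n ≤ ∫ _, _ ∂directionLaw n :=
    integral_mono (integrable_finsetSum _ hintegrable) (integrable_const _) fun y =>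
      sum_regretModel_le hR hX hne hη hβ hηL hf hT (fun t => by simp) hp
  rw [integral_finsetSum _ hintegrable, integral_const, probReal_univ, one_smul] at hmodel
  have hround := Finset.sum_le_sum fun t ht =>
    sub_integral_reward_pivot_le (η := fun _ => η) hR hX hne hβ.le hc hf ht (interior_subset hp)
  have hlog := sum_div_le_log (c := ℓ / (η * β)) (by positivity) T
  simp only [div_div] at hlog
  rw [Finset.sum_add_distrib] at hround
  linarith

lemma sum_sub_integral_reward_pivot_le (hν : 0 ≤ ν) (hXc : Convex ℝ X) (hp : p ∈ X) :
    ∑ t ∈ Finset.Icc 1 T,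
        (f t p - ∫ y, f t (pivot X R β (fun _ => η) f (fun s => y s) t) ∂directionLaw n) ≤
      10 * L + ν * Real.log T / η + 2 * T * η * (n * L) ^ 2 +
        ℓ / (η * β) * (1 + Real.log T) := by
  have hT' : (1 : ℝ) ≤ T := by exact_mod_cast hT
  have hx₁ := (hR.argmin_spec hX hne).1
  set x₁ := argmin (interior X) R
  -- Shrinking `X` towards `x₁` by `1 / T` costs `2 * L` in reward and `ν * log T` in the barrier.
  have hreward := sum_le_sum_add_of_concaveOn_of_abs_le hT
    (fun t ht => (hf t ht).concaveOn hβ.le) (fun t ht => (hf t ht).bounded)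
    (interior_subset hx₁) hp
  have hs : 1 - 1 / (T : ℝ) ∈ Ico (0 : ℝ) 1 :=
    ⟨sub_nonneg.2 ((div_le_one (by linarith)).2 hT'), sub_lt_self _ (by positivity)⟩
  set s : ℝ := 1 - 1 / T with hs_def
  have hmem : x₁ + s • (p - x₁) ∈ interior X := by
    convert hXc.add_smul_sub_mem_interior hp hx₁ (t := 1 - s)
      ⟨by linarith [hs.2], by linarith [hs.1]⟩ using 1
    module
  have hbarrier : R (x₁ + s • (p - x₁)) - R x₁ ≤ ν * Real.log T := by
    simpa [hs_def] using hR.sub_le_log hν hXc hx₁ hp hs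
  have hinterior := sum_sub_integral_reward_pivot_le_of_mem_interior hR hX hne hβ hη hηL hf hT hmem
  rw [Finset.sum_sub_distrib] at hinterior ⊢
  linarith [div_le_div_of_nonneg_right hbarrier hη.le]

end ExpectedRegret

section Transfer

variable {Z : Type*} [TopologicalSpace Z] [CompactSpace Z] [MeasurableSpace Z]
  [BorelSpace Z] {μ : Measure Z} [IsFiniteMeasure μ] {Ω : Type*} [MeasurableSpace Ω]
  {P : Measure Ω} {ζ : Ω → Z} (hζ : HasLaw ζ μ P)
include hζ

lemma integrable_comp_of_hasLaw {F : Z → ℝ} (hF : Continuous F) :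
    Integrable (fun ω => F (ζ ω)) P := by
  have hint := integrable_of_continuous hF μ
  rw [← hζ.map_eq] at hint
  exact hint.comp_aemeasurable hζ.aemeasurable

lemma exists_isRegret_of_hasLaw {n T : ℕ} {X : Set (Eucl n)} (hX : IsCompact X) (hne : X.Nonempty)
    {f : ℕ → Eucl n → ℝ} (hf : ∀ t ∈ Finset.Icc 1 T, ContinuousOn (f t) X) {Y : ℕ → Z → Eucl n}
    (hY : ∀ t ∈ Finset.Icc 1 T, Continuous fun z => f t (Y t z)) {B : ℝ}
    (hB : ∀ p ∈ X, ∑ t ∈ Finset.Icc 1 T, (f t p - ∫ z, f t (Y t z) ∂μ) ≤ B) :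
    ∃ r, IsRegret P X T f (fun t ω => Y t (ζ ω)) r ∧ r ≤ B := by
  have hlaw : ∀ t ∈ Finset.Icc 1 T, ∫ ω, f t (Y t (ζ ω)) ∂P = ∫ z, f t (Y t z) ∂μ := fun t ht =>
    hζ.integral_comp (integrable_of_continuous (hY t ht) μ).1
  obtain ⟨p, hp, hmax⟩ := hX.exists_isMaxOn hne ((continuousOn_finsetSum _ hf).sub
    (continuousOn_const (c := ∫ ω, ∑ t ∈ Finset.Icc 1 T, f t (Y t (ζ ω)) ∂P)))
  refine ⟨_, ⟨mem_image_of_mem _ hp, forall_mem_image.2 fun q hq => hmax hq⟩, ?_⟩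
  have hBp := hB p hp
  rwa [Finset.sum_sub_distrib, ← Finset.sum_congr rfl hlaw,
    ← integral_finsetSum _ fun t ht => integrable_comp_of_hasLaw hζ (hY t ht)] at hBp

end Transfer

section TunedStep

/-- The constant of the regret bound. Its terms come, in order, from the initial distance together
with the shrinking of the comparator, from the barrier together with the variance of the estimator,
and from the smoothing error. -/
noncomputable def regretConst (n : ℕ) (ν β L : ℝ) (ℓ : ℝ≥0) : ℝ :=
  10 * L + (2 * ν + 1) * (n * L) + 4 * ℓ / β * (n * L)

variable {n : ℕ} {ν β L η : ℝ} {ℓ : ℝ≥0} {T : ℕ}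

lemma tunedStep_mul_le (hη : η = 1 / (2 * n * L * √T)) (hn : 0 < n) (hL : 0 < L) (hT : 1 ≤ T) :
    η * (n * L) ≤ 1 / 2 := by
  have hsqrt : 1 ≤ √(T : ℝ) := Real.one_le_sqrt.2 (by exact_mod_cast hT)
  rw [hη, one_div_mul_eq_div, div_le_div_iff₀ (by positivity) two_pos]
  nlinarith [mul_le_mul_of_nonneg_left hsqrt (by positivity : 0 ≤ n * L)]

lemma regret_bound_le (hη : η = 1 / (2 * n * L * √T)) (hn : 0 < n) (hν : 0 ≤ ν) (hL : 0 < L)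
    (hT : 1 ≤ T) :
    10 * L + ν * Real.log T / η + 2 * T * η * (n * L) ^ 2 + ℓ / (η * β) * (1 + Real.log T) +
      ℓ / (η * β) * (1 + Real.log T) ≤ regretConst n ν β L ℓ * √T * (1 + Real.log T) := by
  have hT' : (1 : ℝ) ≤ T := by exact_mod_cast hT
  have hlog : 0 ≤ Real.log T := Real.log_nonneg hT'
  have hsqrt : 1 ≤ √(T : ℝ) := Real.one_le_sqrt.2 hT'
  have hbarrier : ν * Real.log T / η = 2 * ν * (n * L) * √T * Real.log T := by
    rw [hη]
    field_simp
  have hvariance : 2 * T * η * (n * L) ^ 2 = n * L * √T := by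
    rw [hη]
    nth_rw 1 [← Real.sq_sqrt (by positivity : (0 : ℝ) ≤ T)]
    field_simp
  have hsmoothing : ℓ / (η * β) = 2 * ℓ / β * (n * L) * √T := by
    rw [hη]
    field_simp
  have hone : 1 ≤ √T * (1 + Real.log T) := one_le_mul_of_one_le_of_one_le hsqrt (by linarith)
  have hdiff : regretConst n ν β L ℓ * √T * (1 + Real.log T) - (10 * L +
      2 * ν * (n * L) * √T * Real.log T + n * L * √T +
      2 * (2 * ℓ / β * (n * L) * √T * (1 + Real.log T))) =
      10 * L * (√T * (1 + Real.log T) - 1) + n * L * √T * (2 * ν + Real.log T) := by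
    unfold regretConst
    ring
  rw [hbarrier, hvariance, hsmoothing]
  nlinarith [mul_nonneg hL.le (sub_nonneg.2 hone),
    (by positivity : 0 ≤ n * L * √T * (2 * ν + Real.log T))]

variable {X : Set (Eucl n)} {R : Eucl n → ℝ} {f : ℕ → Eucl n → ℝ} {p : Eucl n}
  (hη : η = 1 / (2 * n * L * √T)) (hn : 0 < n) (hν : 0 ≤ ν) (hβ : 0 < β) (hL : 0 < L) (hT : 1 ≤ T)
  (hR : IsSelfConcordantBarrier ν X R) (hX : IsCompact X) (hXc : Convex ℝ X)
  (hne : (interior X).Nonempty) (hf : ∀ t ∈ Finset.Icc 1 T, IsReward X β L ℓ (f t)) (hp : p ∈ X)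
include hη hn hν hβ hL hT hR hX hXc hne hf hp

lemma sum_sub_integral_reward_action_le_regretConst :
    ∑ t ∈ Finset.Icc 1 T,
        (f t p - ∫ y, f t (action X R β (fun _ => η) f (fun s => y s) t) ∂directionLaw n) ≤
      regretConst n ν β L ℓ * √T * (1 + Real.log T) := by
  have : NeZero n := ⟨hn.ne'⟩
  have hη₀ : 0 < η := by rw [hη]; positivity
  have haction := sum_sub_integral_reward_action_le (p := p) hR hX hne hβ hη₀ hf
  have hpivot := sum_sub_integral_reward_pivot_le hR hX hne hβ hη₀
    (tunedStep_mul_le hη hn hL hT) hf hT hν hXc hp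
  linarith [regret_bound_le (β := β) (ℓ := ℓ) hη hn hν hL hT]

lemma sum_sub_integral_reward_pivot_le_regretConst :
    ∑ t ∈ Finset.Icc 1 T,
        (f t p - ∫ y, f t (pivot X R β (fun _ => η) f (fun s => y s) t) ∂directionLaw n) ≤
      regretConst n ν β L ℓ * √T * (1 + Real.log T) := by
  have : NeZero n := ⟨hn.ne'⟩
  have hη₀ : 0 < η := by rw [hη]; positivity
  have hpivot := sum_sub_integral_reward_pivot_le hR hX hne hβ hη₀
    (tunedStep_mul_le hη hn hL hT) hf hT hν hXc hp
  have hsmoothing : 0 ≤ ℓ / (η * β) * (1 + Real.log T) := by positivity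
  linarith [regret_bound_le (β := β) (ℓ := ℓ) hη hn hν hL hT]

end TunedStep

end EagerBandit

open EagerBandit in
theorem mainTheorem1 (n : ℕ) (hn : 1 ≤ n) (ν β L : ℝ) (ℓ : ℝ≥0)
    (hν : 0 ≤ ν) (hβ : 0 < β) (hL : 0 < L) :
    ∃ C : ℝ, ∀ (X : Set (Eucl n)) (R : Eucl n → ℝ),
      IsClosed X → Convex ℝ X → (interior X).Nonempty →
      IsSelfConcordantBarrier ν X R →
      ∀ (T : ℕ), 1 ≤ T → ∀ (η : ℕ → ℝ), (∀ t, η t = 1 / (2 * n * L * √T)) →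
      ∀ (f : ℕ → Eucl n → ℝ), (∀ t ∈ Finset.Icc 1 T, IsReward X β L ℓ (f t)) →
      ∀ (Ω : Type*) [MeasurableSpace Ω] (P : Measure Ω) [IsProbabilityMeasure P]
        (z : ℕ → Ω → Metric.sphere (0 : Eucl n) 1),
        (∀ t, Measurable (z t)) → iIndepFun z P → (∀ t, P.map (z t) = sphereUniform n) →
      ∀ (x xhat : ℕ → Ω → Eucl n),
        (∀ t ω, x t ω = pivot X R β η f (fun s => (z s ω : Eucl n)) t) →
        (∀ t ω, xhat t ω = action X R β η f (fun s => (z s ω : Eucl n)) t) →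
      (∀ t ∈ Finset.Icc 1 T, (∀ ω, x t ω ∈ interior X ∧ xhat t ω ∈ X) ∧
        Integrable (fun ω => f t (x t ω)) P ∧ Integrable (fun ω => f t (xhat t ω)) P) ∧
      (∃ r, IsRegret P X T f xhat r ∧ r ≤ C * √T * (1 + Real.log T)) ∧
      (∃ r, IsRegret P X T f x r ∧ r ≤ C * √T * (1 + Real.log T)) := by
  refine ⟨regretConst n ν β L ℓ, ?_⟩
  intro X R hXclosed hXc hne hR T hT η hη f hf Ω _ P _ z hz hind hlaw x xhat hx hxhat
  have : NeZero n := ⟨by omega⟩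
  obtain rfl := funext₂ hx
  obtain rfl := funext₂ hxhat
  obtain rfl : η = fun _ => 1 / (2 * n * L * √T) := funext hη
  have hc : ∀ t : ℕ, 0 < 1 / (2 * n * L * √T) * β * (t + 1) := fun t => by positivity
  have hX : IsCompact X := (hf 1 (Finset.mem_Icc.2 ⟨le_rfl, hT⟩)).isCompact hβ hXclosed
  have hf_cont := fun t ht => (hf t ht).continuousOn
  have hpivot := fun t => continuous_reward_pivot (t := t) hR hX hne hc hf
  have haction := fun t => continuous_reward_action (t := t) hR hX hne hc hf
  have hζ := hasLaw_directionLaw hz hind hlaw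
  refine ⟨fun t ht => ⟨fun ω => ⟨pivot_mem_interior hR hX hne _ t,
    interior_subset (action_mem_interior hR hX hne hc (by simp))⟩,
    integrable_comp_of_hasLaw hζ (hpivot t ht), integrable_comp_of_hasLaw hζ (haction t ht)⟩,
    exists_isRegret_of_hasLaw hζ hX (hne.mono interior_subset) hf_cont haction fun p hp => ?_,
    exists_isRegret_of_hasLaw hζ hX (hne.mono interior_subset) hf_cont hpivot fun p hp => ?_⟩
  · exact sum_sub_integral_reward_action_le_regretConst rfl hn hν hβ hL hT hR hX hXc hne hf hp
  · exact sum_sub_integral_reward_pivot_le_regretConst rfl hn hν hβ hL hT hR hX hXc hne hf hp
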